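/- Let $p>0$ be real, and let $\lambda_1<\lambda_2<\cdots$ be the positive roots of $p\sin(\pi\lambda)+\lambda\cos(\pi\lambda)=0$. For $\operatorname{Re}(s)>1$ put $$\zeta_p(s)=\sum_{j=1}^\infty\frac{p^2+\lambda_j^2}{p\left(p+\frac1\pi\right)+\lambda_j^2}\,\frac1{\lambda_j^{s}},\qquad \eta_p(s)=\sum_{k=1}^\infty\frac{(s,2\pi pk)_k}{k^s},$$ where $$(s,\nu k)_k=\frac1{\Gamma(s)}\int_0^\infty e^{-x}\left(\frac{k\nu-x}{k\nu+x}\right)^k x^{s-1}\,dx,$$ and for $\operatorname{Re}(t)>0$ put $$\sigma_p(t)=\sum_{j=1}^\infty\frac{p^2+\lambda_j^2}{p\left(p+\frac1\pi\right)+\lambda_j^2}\,e^{-\lambda_jt}.$$ All these series and integrals converge absolutely, and $\zeta_p$ extends to a holomorphic function on $\mathbb C\setminus\{1\}$, again denoted by $\zeta_p$. There is a sequence of real numbers $B_n^{(2,p)}$, $n\ge0$ (the generalized Bernoulli numbers of the second kind), defined by the generating function $$\sum_{n=0}^\infty\frac{B_n^{(2,p)}}{n!}t^n=t\,\sigma_p(t)\qquad(0<t<1).$$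 For every integer $m\ge1$, $$\zeta_p(-m)=-\frac1{m+1}B_{m+1}^{(2,p)}$$ and $$\eta_p(2m)=\frac{(-1)^{m+1}(2\pi)^{2m}}{2\,(2m)!}B_{2m}^{(2,p)}.$$ -/

import Mathlib

open MeasureTheory Set

noncomputable section

namespace Koshliakov

/-- The positive roots `lambda_1 < lambda_2 < ...` of `p sin(pi x) + x cos(pi x) = 0`.
For `p > 0` every positive root is simple, so a sum over the sequence of roots is a sum
over this set. -/
def roots (p : ℝ) : Set ℝ :=
  {x : ℝ | 0 < x ∧ p * Real.sin (Real.pi * x) + x * Real.cos (Real.pi * x) = 0}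

/-- The weight `(p ^ 2 + x ^ 2) / (p (p + 1 / pi) + x ^ 2)`. -/
def weight (p x : ℝ) : ℝ :=
  (p ^ 2 + x ^ 2) / (p * (p + 1 / Real.pi) + x ^ 2)

/-- The term of the Dirichlet-type series of the first Koshliakov zeta function. -/
def zetaTerm (p : ℝ) (s : ℂ) (x : roots p) : ℂ :=
  (weight p x : ℂ) * (1 / ((x : ℝ) : ℂ) ^ s)

/-- `Z` is holomorphic on the plane with the point `1` removed and is the sum of the (convergent)
series `∑_j weight p lambda_j * lambda_j ^ (-s)` for `Re s > 1`.  By the identity theorem these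
properties determine `Z` on the complement of `{1}`. -/
structure IsZetaContinuation (p : ℝ) (Z : ℂ → ℂ) : Prop where
  differentiableOn : DifferentiableOn ℂ Z {1}ᶜ
  hasSum : ∀ s : ℂ, 1 < s.re → HasSum (zetaTerm p s) (Z s)

/-- The first Koshliakov zeta function `zeta_p`: the analytic continuation of its series to
the complement of `{1}` (its value at `1` has no meaning). -/
def zeta (p : ℝ) : ℂ → ℂ :=
  Classical.epsilon (IsZetaContinuation p)

/-- The integrand of `(s, a)_k`, namely
`exp (-x) * ((a - x) / (a + x)) ^ k * x ^ (s - 1)`. -/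
def bracketIntegrand (s : ℂ) (a : ℝ) (k : ℕ) (x : ℝ) : ℂ :=
  ((Real.exp (-x) * ((a - x) / (a + x)) ^ k : ℝ) : ℂ) * (x : ℂ) ^ (s - 1)

/-- The function `(s, a)_k` (used with `a = nu k`). -/
def bracket (s : ℂ) (a : ℝ) (k : ℕ) : ℂ :=
  1 / Complex.Gamma s * ∫ x in Ioi (0 : ℝ), bracketIntegrand s a k x

/-- The `k`-th term `(s, 2 pi p k)_k / k ^ s` of the series of `eta_p`, for `k ≥ 1`. -/
def etaTerm (p : ℝ) (s : ℂ) (k : ℕ) : ℂ :=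
  bracket s (2 * Real.pi * p * k) k / (k : ℂ) ^ s

/-- The second Koshliakov zeta function `eta_p` in its half plane of definition `Re s > 1`. -/
def eta (p : ℝ) (s : ℂ) : ℂ :=
  ∑' k : ℕ, etaTerm p s (k + 1)

/-- The term `weight p lambda_j * exp (-lambda_j t)` of the series of `sigma_p`. -/
def sigmaTerm (p : ℝ) (t : ℂ) (x : roots p) : ℂ :=
  (weight p x : ℂ) * Complex.exp (-((x : ℝ) : ℂ) * t)

/-- `sigma_p (t) = ∑_j weight p lambda_j * exp (-lambda_j t)`, for `Re t > 0`. -/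
def sigma (p : ℝ) (t : ℂ) : ℂ :=
  ∑' x : roots p, sigmaTerm p t x

/-- The generating function identity `∑_n B_n / n! * t ^ n = t * sigma_p (t)` for `0 < t < 1`.
It determines the sequence `B`, by uniqueness of power series coefficients. -/
def IsBernoulliTwo (p : ℝ) (B : ℕ → ℝ) : Prop :=
  ∀ t : ℝ, 0 < t → t < 1 →
    HasSum (fun n : ℕ => ((B n / (n.factorial : ℝ) * t ^ n : ℝ) : ℂ)) ((t : ℂ) * sigma p t)

/-- The generalized Bernoulli numbers of the second kind `B_n^{(2,p)}`. -/
def bernoulliTwo (p : ℝ) : ℕ → ℝ :=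
  Classical.epsilon (IsBernoulliTwo p)

end Koshliakov

end

noncomputable section

namespace Koshliakov

open Filter Topology

/-! ### The roots and the weights -/

/-! Both formulas come from the moments M_n = ∫_0^∞ y^n K(y) dy, n ≥ 1, of a single kernel K = r /
(1 - r), where r(y) = e^{-2πy} (p - y) / (p + y) (`planaRatio`, `planaKernel`). Write w for `weight
p` and λ for the roots.

Eta: the substitution x = 2πky turns the k-th term of η into a Mellin integral of r^k. Summing the
geometric series gives η(s) = (2π)^s / Γ(s) · ∫ y^{s-1} K(y) dy for Re s > 1 (`eta_eq_mellin`), so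
η(2m) is an explicit multiple of M_{2m-1}.

Partial fractions: w(λ) is π times the residue at λ of the quotient `cosSin p / sinCos p`. On the
imaginary axis this quotient is -i (1 + 2K). The residue theorem on the circles |z| = N yields 1 +
2K(y) - w(0)/(πy) = (2/π) Σ w(λ) y / (λ² + y²) (`hasSum_reducedKernel`).

Zeta: for -1 < Re s < 0 the Mellin transform of this expansion, taken term by term, is ζ(1 - s) /
cos(πs/2). Cutting the integrals at y = 1 shows that the transform of the left side in this strip
and the transform of 2K in Re s > 1 continue each other. Hence ζ(1 - s) = 2 cos(πs/2) ∫ y^{s-1} K(y)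
dy for Re s > 1 (`zeta_one_sub`), and ζ(-m) = 2 cos(π(m+1)/2) M_m.

Sigma: since y / (λ² + y²) has sine transform (π/2) e^{-λt}, the same expansion leads to σ(t) = 1/t
+ c + 2 ∫ sin(yt) K(y) dy (`exists_tsum_weight_mul_exp`). The sine integrals converge only
conditionally, so the identity is proved for a second antiderivative in t and then differentiated
twice. Expanding the sine gives B_n = -2n cos(πn/2) M_{n-1} for n ≥ 2. The constant c affects only
B_1, which occurs in neither formula. Comparison with the values of ζ and η finishes the proof. -/

lemma sin_add_arctan {p : ℝ} (hp : 0 < p) (x : ℝ) :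
    Real.sqrt (1 + (x / p) ^ 2) * p * Real.sin (Real.pi * x + Real.arctan (x / p)) =
      p * Real.sin (Real.pi * x) + x * Real.cos (Real.pi * x) := by
  have h : Real.sqrt (1 + (x / p) ^ 2) ≠ 0 := by positivity
  rw [Real.sin_add, Real.cos_arctan, Real.sin_arctan]
  field_simp

/-- In the phase-amplitude form of the equation, a root is a point where the increasing phase πx +
arctan(x/p) is a multiple of π. The arctangent lies in (0, π/2), so the n-th multiple is reached
between n - 1/2 and n. This reduces every convergence question about roots to a series over ℕ. -/
lemma exists_index {p : ℝ} (hp : 0 < p) (x : roots p) :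
    ∃ n : ℕ, Real.pi * x + Real.arctan (x / p) = n * Real.pi := by
  obtain ⟨x, hx0, hx⟩ := x
  rw [← sin_add_arctan hp] at hx
  have h : Real.sqrt (1 + (x / p) ^ 2) * p ≠ 0 := by positivity
  obtain ⟨n, hn⟩ := Real.sin_eq_zero_iff.1 ((mul_eq_zero.1 hx).resolve_left h)
  have h1 : 0 < Real.arctan (x / p) := Real.arctan_pos.2 (by positivity)
  have h2 : (0 : ℝ) < n * Real.pi := by rw [hn]; positivity
  have h3 : (0 : ℝ) < n := pos_of_mul_pos_left h2 Real.pi_pos.le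
  lift n to ℕ using by exact_mod_cast h3.le
  exact ⟨n, by simpa using hn.symm⟩

/-- The number `n` of a root `x`, so that `n - 1 / 2 < x < n`. -/
def index {p : ℝ} (hp : 0 < p) (x : roots p) : ℕ := (exists_index hp x).choose

lemma index_spec {p : ℝ} (hp : 0 < p) (x : roots p) :
    Real.pi * x + Real.arctan (x / p) = index hp x * Real.pi := (exists_index hp x).choose_spec

lemma index_injective {p : ℝ} (hp : 0 < p) : Function.Injective (index hp) := by
  have hmono : StrictMono fun x : ℝ => Real.pi * x + Real.arctan (x / p) := by
    refine StrictMono.add (fun a b hab => mul_lt_mul_of_pos_left hab Real.pi_pos) fun a b hab => ?_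
    exact Real.arctan_strictMono (div_lt_div_of_pos_right hab hp)
  intro x y hxy
  apply Subtype.ext
  apply hmono.injective
  change Real.pi * x + Real.arctan (x / p) = Real.pi * y + Real.arctan (y / p)
  rw [index_spec hp, index_spec hp, hxy]

lemma countable_roots {p : ℝ} (hp : 0 < p) : Countable (roots p) :=
  (index_injective hp).countable

lemma root_pos {p : ℝ} (x : roots p) : 0 < (x : ℝ) := x.2.1

lemma root_lt_index {p : ℝ} (hp : 0 < p) (x : roots p) : (x : ℝ) < index hp x := by
  have h := index_spec hp x
  have h1 : 0 < Real.arctan (x / p) := Real.arctan_pos.2 (div_pos (root_pos x) hp)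
  nlinarith [Real.pi_pos]

lemma index_lt_root_add {p : ℝ} (hp : 0 < p) (x : roots p) : (index hp x : ℝ) < x + 1 / 2 := by
  have h := index_spec hp x
  have h1 := Real.arctan_lt_pi_div_two (x / p)
  nlinarith [Real.pi_pos]

lemma one_le_index {p : ℝ} (hp : 0 < p) (x : roots p) : 1 ≤ index hp x := by
  have h : (0 : ℝ) < index hp x := (root_pos x).trans (root_lt_index hp x)
  exact_mod_cast h

lemma half_index_le_root {p : ℝ} (hp : 0 < p) (x : roots p) : (index hp x : ℝ) / 2 ≤ x := by
  have h := index_lt_root_add hp x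
  have h1 : (1 : ℝ) ≤ index hp x := by exact_mod_cast one_le_index hp x
  linarith

lemma half_le_root {p : ℝ} (hp : 0 < p) (x : roots p) : 1 / 2 ≤ (x : ℝ) := by
  have h := half_index_le_root hp x
  have h1 : (1 : ℝ) ≤ index hp x := by exact_mod_cast one_le_index hp x
  linarith

lemma summable_of_index {p : ℝ} (hp : 0 < p) {u : ℕ → ℝ} (hu : Summable u) {v : roots p → ℝ}
    (h0 : ∀ x, 0 ≤ v x) (h : ∀ x, v x ≤ u (index hp x)) : Summable v :=
  Summable.of_nonneg_of_le h0 h (hu.comp_injective (index_injective hp))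

lemma summable_root_rpow {p : ℝ} (hp : 0 < p) {a : ℝ} (ha : 1 < a) :
    Summable fun x : roots p => (x : ℝ) ^ (-a) := by
  refine summable_of_index hp (((Real.summable_nat_rpow (p := -a)).2 (by linarith)).mul_left (2 ^ a))
    (fun x => Real.rpow_nonneg (root_pos x).le _) fun x => ?_
  have h1 : (0 : ℝ) < index hp x := by exact_mod_cast one_le_index hp x
  calc (x : ℝ) ^ (-a) ≤ ((index hp x : ℝ) / 2) ^ (-a) :=
        Real.rpow_le_rpow_of_nonpos (by positivity) (half_index_le_root hp x) (by linarith)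
    _ = _ := by
        rw [Real.div_rpow h1.le (by norm_num), Real.rpow_neg (by norm_num : (0 : ℝ) ≤ 2)]
        field_simp

lemma summable_root_inv_sq {p : ℝ} (hp : 0 < p) :
    Summable fun x : roots p => 1 / (x : ℝ) ^ 2 := by
  refine (summable_root_rpow hp one_lt_two).congr fun x => ?_
  rw [Real.rpow_neg (root_pos x).le, one_div]
  norm_cast

lemma summable_exp_neg_root {p : ℝ} (hp : 0 < p) {t : ℝ} (ht : 0 < t) :
    Summable fun x : roots p => Real.exp (-x * t) := by
  have hs : Summable fun n : ℕ => Real.exp (n * (-(t / 2))) :=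
    Real.summable_exp_nat_mul_iff.2 (by linarith)
  refine summable_of_index hp hs (fun x => (Real.exp_pos _).le) fun x => ?_
  apply Real.exp_le_exp.2
  nlinarith [half_index_le_root hp x]

lemma finite_roots_lt {p : ℝ} (hp : 0 < p) (R : ℝ) : {x : roots p | (x : ℝ) < R}.Finite := by
  refine Set.Finite.of_finite_image (f := index hp) ?_ (index_injective hp).injOn
  obtain ⟨N, hN⟩ := exists_nat_ge (R + 1 / 2)
  refine (Set.finite_Iio N).subset ?_
  rintro _ ⟨x, hx, rfl⟩
  have h := index_lt_root_add hp x
  have hx' : (x : ℝ) < R := hx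
  have : (index hp x : ℝ) < N := by linarith
  exact_mod_cast this

lemma weight_pos {p : ℝ} (hp : 0 < p) (x : ℝ) : 0 < weight p x := by
  unfold weight
  have := Real.pi_pos
  positivity

lemma weight_le_one {p : ℝ} (hp : 0 < p) (x : ℝ) : weight p x ≤ 1 := by
  unfold weight
  have := Real.pi_pos
  rw [div_le_one (by positivity)]
  have : 0 < p * (1 / Real.pi) := by positivity
  nlinarith

lemma summable_weight_mul {p : ℝ} (hp : 0 < p) {u : roots p → ℝ} (h0 : ∀ x, 0 ≤ u x)
    (hu : Summable u) : Summable fun x : roots p => weight p x * u x :=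
  Summable.of_nonneg_of_le (fun x => mul_nonneg (weight_pos hp x).le (h0 x))
    (fun x => mul_le_of_le_one_left (h0 x) (weight_le_one hp x)) hu

lemma norm_sigmaTerm {p : ℝ} (hp : 0 < p) (t : ℂ) (x : roots p) :
    ‖sigmaTerm p t x‖ = weight p x * Real.exp (-x * t.re) := by
  rw [sigmaTerm, norm_mul, Complex.norm_real, Real.norm_of_nonneg (weight_pos hp x).le,
    Complex.norm_exp]
  simp

lemma summable_sigmaTerm {p : ℝ} (hp : 0 < p) {t : ℂ} (ht : 0 < t.re) :
    Summable (sigmaTerm p t) := by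
  apply Summable.of_norm
  simp only [norm_sigmaTerm hp]
  exact summable_weight_mul hp (fun x => (Real.exp_pos _).le) (summable_exp_neg_root hp ht)

lemma norm_zetaTerm {p : ℝ} (hp : 0 < p) (s : ℂ) (x : roots p) :
    ‖zetaTerm p s x‖ = weight p x * (x : ℝ) ^ (-s.re) := by
  rw [zetaTerm, norm_mul, Complex.norm_real, Real.norm_of_nonneg (weight_pos hp x).le, norm_div,
    norm_one, Complex.norm_cpow_eq_rpow_re_of_pos (root_pos x), Real.rpow_neg (root_pos x).le,
    one_div]

lemma summable_norm_zetaTerm {p : ℝ} (hp : 0 < p) {s : ℂ} (hs : 1 < s.re) :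
    Summable fun x => ‖zetaTerm p s x‖ := by
  simp only [norm_zetaTerm hp]
  exact summable_weight_mul hp (fun x => Real.rpow_nonneg (root_pos x).le _)
    (summable_root_rpow hp hs)

/-! ### A residue formula for quotients with simple poles -/

/-- The poles are removed one at a time: after subtracting r(a)/(z - a), the product with z - a
tends to 0 and Riemann's theorem fills in the point, while the limits at the other poles do not
change. F is quantified after T so that the induction applies to the modified function. -/
lemma exists_differentiableOn_sub_poles {U : Set ℂ} (hU : IsOpen U) (r : ℂ → ℂ) (T : Finset ℂ) :
    ∀ F : ℂ → ℂ, (T : Set ℂ) ⊆ U → DifferentiableOn ℂ F (U \ T) →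
      (∀ a ∈ T, Tendsto (fun z => (z - a) * F z) (𝓝[≠] a) (𝓝 (r a))) →
      ∃ G : ℂ → ℂ, DifferentiableOn ℂ G U ∧
        ∀ z ∈ U \ T, F z = G z + ∑ a ∈ T, r a * (z - a)⁻¹ := by
  induction T using Finset.induction_on with
  | empty =>
    intro F _ hF _
    exact ⟨F, by simpa using hF, by simp⟩
  | insert a T ha ih =>
    intro F hT hF hr
    have haU : a ∈ U := hT (by simp)
    have hV : IsOpen (U \ (T : Set ℂ)) := hU.sdiff T.finite_toSet.isClosed
    have haV : U \ (T : Set ℂ) ∈ 𝓝 a := hV.mem_nhds ⟨haU, by simpa using ha⟩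
    set F₁ : ℂ → ℂ := fun z => F z - r a * (z - a)⁻¹ with hF₁
    have hd : DifferentiableOn ℂ F₁ ((U \ (T : Set ℂ)) \ {a}) := by
      refine (hF.mono ?_).sub ?_
      · rintro z ⟨⟨h1, h2⟩, h3⟩
        exact ⟨h1, by simpa using ⟨h3, h2⟩⟩
      · refine DifferentiableOn.const_mul (DifferentiableOn.inv (by fun_prop) ?_) _
        rintro z ⟨-, h3⟩
        exact sub_ne_zero.2 h3
    have hlim : Tendsto (fun z => (z - a) * (F₁ z - F₁ a)) (𝓝[≠] a) (𝓝 0) := by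
      have h1 : Tendsto (fun z => (z - a) * F z - r a - (z - a) * F₁ a) (𝓝[≠] a)
          (𝓝 (r a - r a - (a - a) * F₁ a)) := by
        refine ((hr a (by simp)).sub_const _).sub (Tendsto.mul_const _ ?_)
        exact ((continuous_id.sub continuous_const).tendsto a).mono_left nhdsWithin_le_nhds
      rw [sub_self, sub_self, zero_mul, sub_zero] at h1
      refine h1.congr' ?_
      filter_upwards [self_mem_nhdsWithin] with z hz
      have hz' : z - a ≠ 0 := sub_ne_zero.2 hz
      simp only [hF₁]
      field_simp
    have ho : (fun z => F₁ z - F₁ a) =o[𝓝[≠] a] fun z => (z - a)⁻¹ := by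
      refine (Asymptotics.isLittleO_iff_tendsto' ?_).2 ?_
      · filter_upwards [self_mem_nhdsWithin] with z hz h
        exact absurd h (inv_ne_zero (sub_ne_zero.2 hz))
      · refine hlim.congr fun z => ?_
        rw [div_inv_eq_mul, mul_comm]
    have hd₂ := Complex.differentiableOn_update_limUnder_of_isLittleO haV hd ho
    set F₂ := Function.update F₁ a (limUnder (𝓝[≠] a) F₁)
    have hF₂ : ∀ z, z ≠ a → F₂ z = F z - r a * (z - a)⁻¹ := fun z hz => by
      simp [F₂, hz, hF₁]
    obtain ⟨G, hG, hGe⟩ := ih F₂ (fun z hz => hT (by simp [Finset.mem_coe.1 hz])) hd₂ (by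
      intro b hb
      have hba : b ≠ a := fun h => ha (h ▸ hb)
      have h1 : Tendsto (fun z => (z - b) * F z - (z - b) * (r a * (z - a)⁻¹)) (𝓝[≠] b)
          (𝓝 (r b - (b - b) * (r a * (b - a)⁻¹))) := by
        refine (hr b (by simp [hb])).sub ?_
        have : ContinuousAt (fun z => (z - b) * (r a * (z - a)⁻¹)) b := by
          have : b - a ≠ 0 := sub_ne_zero.2 hba
          fun_prop (disch := assumption)
        exact this.tendsto.mono_left nhdsWithin_le_nhds
      rw [sub_self, zero_mul, sub_zero] at h1
      refine h1.congr' ?_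
      have : ∀ᶠ z in 𝓝[≠] b, z ≠ a :=
        (eventually_ne_nhds hba).filter_mono nhdsWithin_le_nhds
      filter_upwards [this] with z hz
      rw [hF₂ z hz, mul_sub])
    refine ⟨G, hG, ?_⟩
    rintro z ⟨hzU, hz⟩
    simp only [Finset.coe_insert, Set.mem_insert_iff, not_or] at hz
    have h := hGe z ⟨hzU, hz.2⟩
    rw [hF₂ z hz.1] at h
    rw [Finset.sum_insert ha, eq_add_of_sub_eq h]
    ring

lemma tendsto_sub_mul_div {N D : ℂ → ℂ} {a d : ℂ} (hN : ContinuousAt N a) (hD : HasDerivAt D d a)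
    (h0 : D a = 0) (hd : d ≠ 0) :
    Tendsto (fun z => (z - a) * (N z / D z)) (𝓝[≠] a) (𝓝 (N a / d)) := by
  have h1 := (hN.tendsto.mono_left nhdsWithin_le_nhds).div
    (hasDerivAt_iff_tendsto_slope.1 hD) hd
  refine h1.congr fun z => ?_
  rw [Pi.div_apply, slope_def_field, h0, sub_zero, div_div_eq_mul_div]
  ring

/-- The residue theorem on a circle for the quotient of two entire functions with simple zeros of
the denominator. -/
lemma circleIntegral_div_eq_sum {N D : ℂ → ℂ} (hN : Differentiable ℂ N) (hD : Differentiable ℂ D)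
    {R : ℝ} (hR : 0 ≤ R) (T : Finset ℂ) (hT : ∀ z ∈ T, z ∈ Metric.ball (0 : ℂ) R)
    (hzero : ∀ z ∈ Metric.closedBall (0 : ℂ) R, D z = 0 ↔ z ∈ T)
    (hsimple : ∀ z ∈ T, deriv D z ≠ 0) :
    (∮ z in C(0, R), N z / D z) = 2 * Real.pi * Complex.I * ∑ a ∈ T, N a / deriv D a := by
  -- An open neighbourhood of the closed disc without further zeros of D: no zero lies on the
  -- circle, because T is inside the open disc.
  set U : Set ℂ := Metric.ball 0 R ∪ {z | D z ≠ 0}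
  have hU : IsOpen U := Metric.isOpen_ball.union (isOpen_ne_fun hD.continuous continuous_const)
  have hsphere : ∀ z ∈ Metric.sphere (0 : ℂ) R, z ∉ T := fun z hz hzT => by
    have := hT z hzT
    rw [Metric.mem_ball] at this
    rw [Metric.mem_sphere] at hz
    linarith
  have hcU : Metric.closedBall 0 R ⊆ U := by
    intro z hz
    rcases (Metric.mem_closedBall.1 hz).lt_or_eq with h | h
    · exact Or.inl h
    · exact Or.inr fun h0 => hsphere z h ((hzero z hz).1 h0)
  obtain ⟨G, hG, hGe⟩ := exists_differentiableOn_sub_poles hU (fun a => N a / deriv D a) T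
    (fun z => N z / D z) (fun z hz => Or.inl (hT z hz)) (by
      refine hN.differentiableOn.div hD.differentiableOn ?_
      rintro z ⟨hz | hz, hzT⟩
      · exact fun h0 => hzT ((hzero z (Metric.ball_subset_closedBall hz)).1 h0)
      · exact hz)
    (fun a ha => tendsto_sub_mul_div hN.continuous.continuousAt (hD a).hasDerivAt
      ((hzero a (Metric.ball_subset_closedBall (hT a ha))).2 ha) (hsimple a ha))
  have hsum : (∮ z in C(0, R), N z / D z) =
      ∮ z in C(0, R), (G z + ∑ a ∈ T, N a / deriv D a * (z - a)⁻¹) :=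
    circleIntegral.integral_congr hR fun z hz =>
      hGe z ⟨hcU (Metric.sphere_subset_closedBall hz), hsphere z hz⟩
  have hci : ∀ a ∈ T, CircleIntegrable (fun z => N a / deriv D a * (z - a)⁻¹) 0 R := by
    intro a ha
    refine ContinuousOn.circleIntegrable hR ?_
    refine ContinuousOn.mul continuousOn_const (ContinuousOn.inv₀ (by fun_prop) ?_)
    rintro z hz h0
    exact hsphere z hz (sub_eq_zero.1 h0 ▸ ha)
  have hG0 : (∮ z in C(0, R), G z) = 0 :=
    Complex.circleIntegral_eq_zero_of_differentiable_on_off_countable hR countable_empty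
      (hG.continuousOn.mono hcU) fun z hz =>
        (hG z (Or.inl hz.1)).differentiableAt (hU.mem_nhds (Or.inl hz.1))
  rw [hsum, circleIntegral.integral_add
    ((hG.continuousOn.mono (Metric.sphere_subset_closedBall.trans hcU)).circleIntegrable hR)
    (CircleIntegrable.fun_sum T hci), hG0, zero_add, circleIntegral.integral_fun_sum hci,
    Finset.mul_sum]
  refine Finset.sum_congr rfl fun a ha => ?_
  rw [circleIntegral.integral_const_mul, circleIntegral.integral_sub_inv_of_mem_ball (hT a ha)]
  ring

/-! ### The quotient with poles at the roots -/

/-- The function whose positive real zeros are the roots. -/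
def sinCos (p : ℝ) (z : ℂ) : ℂ := p * Complex.sin (Real.pi * z) + z * Complex.cos (Real.pi * z)

/-- The numerator; `cosSin p / sinCos p` has residue `weight p x / π` at each root `x`. -/
def cosSin (p : ℝ) (z : ℂ) : ℂ := p * Complex.cos (Real.pi * z) - z * Complex.sin (Real.pi * z)

/-- The quotient of the two exponential terms of `sinCos`. -/
def expQuot (p : ℝ) (z : ℂ) : ℂ :=
  Complex.exp (2 * Real.pi * Complex.I * z) * ((z - Complex.I * p) / (z + Complex.I * p))

lemma sinCos_neg (p : ℝ) (z : ℂ) : sinCos p (-z) = -sinCos p z := by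
  simp [sinCos]; ring

lemma cosSin_neg (p : ℝ) (z : ℂ) : cosSin p (-z) = cosSin p z := by
  simp [cosSin]

lemma add_I_mul_ne_zero {p : ℝ} (hp : 0 < p) {z : ℂ} (hz : 0 ≤ z.im) : z + Complex.I * p ≠ 0 := by
  intro h
  have := congrArg Complex.im h
  simp at this
  linarith

/-- In exponentials the function is e^{πiz} (z - ip)/2 + e^{-πiz} (z + ip)/2. The second term
dominates in the upper half plane and is factored out. -/
lemma sinCos_eq {p : ℝ} (hp : 0 < p) {z : ℂ} (hz : 0 ≤ z.im) :
    sinCos p z = Complex.exp (-(Real.pi * z * Complex.I)) * (z + Complex.I * p) / 2 *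
      (1 + expQuot p z) := by
  have h := add_I_mul_ne_zero hp hz
  have hE : Complex.exp (2 * Real.pi * Complex.I * z) =
      Complex.exp (Real.pi * z * Complex.I) * Complex.exp (Real.pi * z * Complex.I) := by
    rw [← Complex.exp_add]; ring_nf
  have hE' : Complex.exp (-(Real.pi * z * Complex.I)) =
    (Complex.exp (Real.pi * z * Complex.I))⁻¹ := Complex.exp_neg _
  have hne := Complex.exp_ne_zero (Real.pi * z * Complex.I)
  rw [sinCos, expQuot, Complex.sin, Complex.cos, hE, neg_mul, hE']
  generalize Complex.exp (Real.pi * z * Complex.I) = E at *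
  clear hE hE' hz
  generalize hA : z + Complex.I * p = A at *
  obtain rfl : z = A - Complex.I * p := by rw [← hA]; ring
  field_simp
  ring_nf

lemma cosSin_eq {p : ℝ} (hp : 0 < p) {z : ℂ} (hz : 0 ≤ z.im) :
    cosSin p z = Complex.I * (Complex.exp (-(Real.pi * z * Complex.I)) * (z + Complex.I * p) / 2) *
      (expQuot p z - 1) := by
  have h := add_I_mul_ne_zero hp hz
  have hE : Complex.exp (2 * Real.pi * Complex.I * z) =
      Complex.exp (Real.pi * z * Complex.I) * Complex.exp (Real.pi * z * Complex.I) := by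
    rw [← Complex.exp_add]; ring_nf
  have hE' : Complex.exp (-(Real.pi * z * Complex.I)) =
    (Complex.exp (Real.pi * z * Complex.I))⁻¹ := Complex.exp_neg _
  have hne := Complex.exp_ne_zero (Real.pi * z * Complex.I)
  rw [cosSin, expQuot, Complex.sin, Complex.cos, hE, neg_mul, hE']
  generalize Complex.exp (Real.pi * z * Complex.I) = E at *
  clear hE hE' hz
  generalize hA : z + Complex.I * p = A at *
  obtain rfl : z = A - Complex.I * p := by rw [← hA]; ring
  field_simp
  linear_combination (E ^ 2 + 1) * p * Complex.I_sq

/-- A point of the closed upper half plane is at least as close to ip as to -ip. -/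
lemma norm_sub_le_norm_add {p : ℝ} (hp : 0 < p) {z : ℂ} (hz : 0 ≤ z.im) :
    ‖z - Complex.I * p‖ ≤ ‖z + Complex.I * p‖ := by
  rw [Complex.norm_def, Complex.norm_def]
  apply Real.sqrt_le_sqrt
  simp only [Complex.normSq_apply]
  simp
  nlinarith [mul_nonneg hz hp.le]

lemma norm_quot_le_one {p : ℝ} (hp : 0 < p) {z : ℂ} (hz : 0 ≤ z.im) :
    ‖(z - Complex.I * p) / (z + Complex.I * p)‖ ≤ 1 := by
  rw [norm_div]
  exact div_le_one_of_le₀ (norm_sub_le_norm_add hp hz) (norm_nonneg _)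

lemma norm_expQuot_le {p : ℝ} (hp : 0 < p) {z : ℂ} (hz : 0 ≤ z.im) :
    ‖expQuot p z‖ ≤ Real.exp (-(2 * Real.pi * z.im)) := by
  rw [expQuot, norm_mul, Complex.norm_exp]
  have : (2 * Real.pi * Complex.I * z).re = -(2 * Real.pi * z.im) := by simp
  rw [this]
  exact mul_le_of_le_one_right (Real.exp_pos _).le (norm_quot_le_one hp hz)

lemma sinCos_ne_zero_of_im_pos {p : ℝ} (hp : 0 < p) {z : ℂ} (hz : 0 < z.im) : sinCos p z ≠ 0 := by
  rw [sinCos_eq hp hz.le]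
  have h1 : ‖expQuot p z‖ < 1 := (norm_expQuot_le hp hz.le).trans_lt
    (Real.exp_lt_one_iff.2 (by have := Real.pi_pos; simp only [neg_lt_zero]; positivity))
  have h2 : 1 + expQuot p z ≠ 0 := by
    intro h
    rw [← neg_eq_iff_add_eq_zero.2 h] at h1
    simp at h1
  have h3 := add_I_mul_ne_zero hp hz.le
  have h4 := Complex.exp_ne_zero (-(Real.pi * z * Complex.I))
  exact mul_ne_zero (div_ne_zero (mul_ne_zero h4 h3) two_ne_zero) h2

/-- Above the real axis |`expQuot`| < 1 excludes zeros; oddness carries this to the lower half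
plane. -/
lemma im_eq_zero_of_sinCos_eq_zero {p : ℝ} (hp : 0 < p) {z : ℂ} (hz : sinCos p z = 0) :
    z.im = 0 := by
  rcases lt_trichotomy z.im 0 with h | h | h
  · refine absurd ?_ (sinCos_ne_zero_of_im_pos hp (z := -z) (by simpa using h))
    rw [sinCos_neg, hz, neg_zero]
  · exact h
  · exact absurd hz (sinCos_ne_zero_of_im_pos hp h)

/-! ### Bounds on the circles of integer radius -/

lemma norm_exp_two_pi_sub_one_le (n : ℤ) (x : ℝ) :
    ‖Complex.exp (Complex.I * (2 * Real.pi * x : ℝ)) - 1‖ ≤ 2 * Real.pi * |x - n| := by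
  have h := Real.norm_exp_I_mul_ofReal_sub_one_le (x := 2 * Real.pi * (x - n))
  have h2 : Complex.exp (Complex.I * (2 * Real.pi * x : ℝ)) =
      Complex.exp (Complex.I * (2 * Real.pi * (x - n) : ℝ)) := by
    rw [Complex.exp_eq_exp_iff_exists_int]
    exact ⟨n, by push_cast; ring⟩
  rw [h2]
  refine h.trans_eq ?_
  rw [norm_mul, Real.norm_of_nonneg Real.two_pi_pos.le, Real.norm_eq_abs]

/-- Away from the real axis `expQuot` is small. Near it the circle passes close to ±N, where
`expQuot` is close to the positive real axis and so cannot approach -1. -/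
lemma half_le_norm_one_add_expQuot {p : ℝ} (hp : 0 < p) {N : ℕ} (hN : 1 ≤ N) (hpN : 8 * p ≤ N)
    {z : ℂ} (hz : ‖z‖ = N) (him : 0 ≤ z.im) : 1 / 2 ≤ ‖1 + expQuot p z‖ := by
  have hN' : (1 : ℝ) ≤ N := by exact_mod_cast hN
  rcases le_or_gt (1 / 8) z.im with h | h
  -- 2π · (1/8) = π/4 exceeds log 2.
  · have h1 : ‖expQuot p z‖ ≤ 1 / 2 := by
      refine (norm_expQuot_le hp him).trans ?_
      rw [← Real.le_log_iff_exp_le (by norm_num), one_div, Real.log_inv, neg_le_neg_iff]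
      nlinarith [Real.log_two_lt_d9, Real.pi_gt_d2]
    have h2 := norm_sub_norm_le 1 (-expQuot p z)
    rw [norm_neg, sub_neg_eq_add, norm_one] at h2
    linarith
  · have hsq : z.re ^ 2 + z.im ^ 2 = (N : ℝ) ^ 2 := by
      rw [← hz, Complex.sq_norm, Complex.normSq_apply]; ring
    -- (N - |Re z|)(N + |Re z|) = (Im z)² < 1/64, and the second factor is at least 1.
    obtain ⟨n, hn⟩ : ∃ n : ℤ, |z.re - n| ≤ 1 / 64 := by
      rcases le_total 0 z.re with h0 | h0
      · refine ⟨N, ?_⟩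
        push_cast
        rw [abs_le]
        constructor <;> nlinarith
      · refine ⟨-N, ?_⟩
        push_cast
        rw [abs_le]
        constructor <;> nlinarith
    set v := (z - Complex.I * p) / (z + Complex.I * p) with hv
    set e := Complex.exp (Complex.I * (2 * Real.pi * z.re : ℝ)) with he
    have he1 : ‖e - 1‖ ≤ 1 / 10 := by
      refine (norm_exp_two_pi_sub_one_le n z.re).trans ?_
      nlinarith [Real.pi_lt_d2, Real.pi_pos, abs_nonneg (z.re - n)]
    have hv1 : ‖v - 1‖ ≤ 1 / 4 := by
      have hne := add_I_mul_ne_zero hp him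
      have h1 : v - 1 = -(2 * Complex.I * p) / (z + Complex.I * p) := by
        rw [hv, div_sub_one hne]; ring
      -- 2z is the sum of z + ip and z - ip, of which the first is the longer.
      have h2 : (N : ℝ) ≤ ‖z + Complex.I * p‖ := by
        have h3 : ‖(2 : ℂ) * z‖ ≤ ‖z + Complex.I * p‖ + ‖z - Complex.I * p‖ := by
          refine le_trans (le_of_eq ?_) (norm_add_le _ _)
          ring_nf
        have h4 := norm_sub_le_norm_add hp him
        rw [norm_mul, hz] at h3
        norm_num at h3
        linarith
      rw [h1, norm_div, norm_neg, norm_mul, norm_mul, Complex.norm_I, Complex.norm_real,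
        Real.norm_of_nonneg hp.le, div_le_iff₀ (by linarith)]
      norm_num
      linarith
    have hw : ‖e * v - 1‖ ≤ 1 / 2 := by
      have : e * v - 1 = (e - 1) * v + (v - 1) := by ring
      rw [this]
      refine (norm_add_le _ _).trans ?_
      rw [norm_mul]
      nlinarith [norm_quot_le_one hp him, norm_nonneg (e - 1), norm_nonneg v]
    have hre : 0 ≤ (e * v).re := by
      have := (abs_le.1 ((Complex.abs_re_le_norm _).trans hw)).1
      simp only [Complex.sub_re, Complex.one_re] at this
      linarith
    -- A positive multiple of a number with nonnegative real part, so 1 + `expQuot` has real part at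
    -- least 1.
    have hq : expQuot p z = (Real.exp (-(2 * Real.pi * z.im)) : ℝ) * (e * v) := by
      rw [expQuot, ← hv, ← mul_assoc, he, Complex.ofReal_exp, ← Complex.exp_add]
      congr 2
      apply Complex.ext <;> simp
    have : 1 ≤ (1 + expQuot p z).re := by
      rw [hq, Complex.add_re, Complex.re_ofReal_mul, Complex.one_re]
      have := mul_nonneg (Real.exp_pos (-(2 * Real.pi * z.im))).le hre
      linarith
    linarith [Complex.re_le_norm (1 + expQuot p z)]

/-- With q = `expQuot p z`, the ratio of the moduli is |q - 1| / |1 + q| ≤ 2 / (1/2). -/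
lemma norm_cosSin_le_aux {p : ℝ} (hp : 0 < p) {N : ℕ} (hN : 1 ≤ N) (hpN : 8 * p ≤ N)
    {z : ℂ} (hz : ‖z‖ = N) (him : 0 ≤ z.im) :
    sinCos p z ≠ 0 ∧ ‖cosSin p z‖ ≤ 4 * ‖sinCos p z‖ := by
  have h := half_le_norm_one_add_expQuot hp hN hpN hz him
  constructor
  · rw [sinCos_eq hp him]
    have h2 : 1 + expQuot p z ≠ 0 := by
      intro h0
      rw [h0, norm_zero] at h
      norm_num at h
    have h3 := add_I_mul_ne_zero hp him
    have h4 := Complex.exp_ne_zero (-(Real.pi * z * Complex.I))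
    exact mul_ne_zero (div_ne_zero (mul_ne_zero h4 h3) two_ne_zero) h2
  · rw [sinCos_eq hp him, cosSin_eq hp him, norm_mul, norm_mul Complex.I, Complex.norm_I, one_mul,
      norm_mul _ (1 + _)]
    have h1 : ‖expQuot p z - 1‖ ≤ 2 := by
      refine (norm_sub_le _ _).trans ?_
      rw [norm_one]
      have := (norm_expQuot_le hp him).trans (Real.exp_le_one_iff.2
        (by have := Real.pi_pos; simp only [neg_nonpos]; positivity))
      linarith
    have := norm_nonneg (Complex.exp (-(Real.pi * z * Complex.I)) * (z + Complex.I * p) / 2)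
    nlinarith

lemma norm_cosSin_le {p : ℝ} (hp : 0 < p) {N : ℕ} (hN : 1 ≤ N) (hpN : 8 * p ≤ N)
    {z : ℂ} (hz : ‖z‖ = N) : sinCos p z ≠ 0 ∧ ‖cosSin p z‖ ≤ 4 * ‖sinCos p z‖ := by
  rcases le_total 0 z.im with h | h
  · exact norm_cosSin_le_aux hp hN hpN hz h
  · have := norm_cosSin_le_aux hp hN hpN (z := -z) (by simpa using hz) (by simpa using h)
    rwa [sinCos_neg, cosSin_neg, neg_ne_zero, norm_neg] at this

/-! ### Zeros and residues of the quotient -/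

lemma hasDerivAt_sinCos (p : ℝ) (z : ℂ) :
    HasDerivAt (sinCos p) (p * (Real.pi * Complex.cos (Real.pi * z)) +
      (Complex.cos (Real.pi * z) - z * (Real.pi * Complex.sin (Real.pi * z)))) z := by
  have h0 : HasDerivAt (fun z : ℂ => Real.pi * z) (Real.pi : ℂ) z := by
    simpa using (hasDerivAt_id z).const_mul (Real.pi : ℂ)
  have h1 : HasDerivAt (fun z : ℂ => (p : ℂ) * Complex.sin (Real.pi * z)) _ z :=
    h0.csin.const_mul (p : ℂ)
  have h2 : HasDerivAt (fun z : ℂ => z * Complex.cos (Real.pi * z)) _ z :=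
    (hasDerivAt_id z).mul h0.ccos
  refine HasDerivAt.congr_deriv (f := sinCos p) (h1.add h2) ?_
  simp only [id]
  ring

lemma differentiable_sinCos (p : ℝ) : Differentiable ℂ (sinCos p) :=
  fun z => (hasDerivAt_sinCos p z).differentiableAt

lemma differentiable_cosSin (p : ℝ) : Differentiable ℂ (cosSin p) := by
  unfold cosSin
  fun_prop

lemma sinCos_ofReal (p x : ℝ) :
    sinCos p x = (p * Real.sin (Real.pi * x) + x * Real.cos (Real.pi * x) : ℝ) := by
  simp [sinCos]

/-- At a zero, sin(πx) = -x cos(πx)/p. Substituted in numerator and derivative, this leaves a common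
factor cos(πx), which is nonzero, and the quotient of what remains is the weight over π. The zero x
= 0 and the negative zeros are included. -/
lemma residue_at_real_zero {p : ℝ} (hp : 0 < p) {x : ℝ} (hx : sinCos p x = 0) :
    deriv (sinCos p) x ≠ 0 ∧
      cosSin p x / deriv (sinCos p) x = (weight p x / Real.pi : ℝ) := by
  rw [sinCos_ofReal] at hx
  have hx' : p * Real.sin (Real.pi * x) + x * Real.cos (Real.pi * x) = 0 := by exact_mod_cast hx
  have hpi := Real.pi_pos
  have hsin : Real.sin (Real.pi * x) = -(x * Real.cos (Real.pi * x)) / p := by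
    field_simp; linarith
  have hcos : Real.cos (Real.pi * x) ≠ 0 := by
    intro h
    have := Real.sin_sq_add_cos_sq (Real.pi * x)
    rw [hsin, h] at this
    norm_num at this
  have hd : deriv (sinCos p) x =
      (Real.cos (Real.pi * x) * (Real.pi / p) * (p * (p + 1 / Real.pi) + x ^ 2) : ℝ) := by
    rw [(hasDerivAt_sinCos p x).deriv]
    have : (p * (Real.pi * Complex.cos (Real.pi * x)) + (Complex.cos (Real.pi * x)
        - x * (Real.pi * Complex.sin (Real.pi * x))) : ℂ) =
        (p * (Real.pi * Real.cos (Real.pi * x)) + (Real.cos (Real.pi * x)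
        - x * (Real.pi * Real.sin (Real.pi * x))) : ℝ) := by simp
    rw [this, hsin]
    congr 1
    field_simp
    ring
  have hc : cosSin p x = (Real.cos (Real.pi * x) * ((p ^ 2 + x ^ 2) / p) : ℝ) := by
    have : cosSin p x = (p * Real.cos (Real.pi * x) - x * Real.sin (Real.pi * x) : ℝ) := by
      simp [cosSin]
    rw [this, hsin]
    congr 1
    field_simp
    ring
  have hpos : 0 < p * (p + 1 / Real.pi) + x ^ 2 := by positivity
  constructor
  · rw [hd, Complex.ofReal_ne_zero]
    positivity
  · rw [hd, hc, ← Complex.ofReal_div]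
    congr 1
    rw [weight]
    field_simp

lemma sinCos_root {p : ℝ} (x : roots p) : sinCos p (x : ℝ) = 0 := by
  rw [sinCos_ofReal, x.2.2, Complex.ofReal_zero]

lemma eq_root_of_sinCos_eq_zero {p : ℝ} (hp : 0 < p) {z : ℂ} (hz : sinCos p z = 0) :
    z = 0 ∨ ∃ x : roots p, z = (x : ℝ) ∨ z = -((x : ℝ) : ℂ) := by
  obtain ⟨x, rfl⟩ : ∃ x : ℝ, z = x :=
    ⟨z.re, Complex.ext rfl (by simpa using im_eq_zero_of_sinCos_eq_zero hp hz)⟩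
  rcases lt_trichotomy x 0 with h | h | h
  · refine Or.inr ⟨⟨-x, by linarith, ?_⟩, Or.inr (by simp)⟩
    have h1 : sinCos p ((-x : ℝ) : ℂ) = 0 := by
      rw [Complex.ofReal_neg, sinCos_neg, hz, neg_zero]
    rw [sinCos_ofReal] at h1
    exact_mod_cast h1
  · exact Or.inl (by simp [h])
  · refine Or.inr ⟨⟨x, h, ?_⟩, Or.inl rfl⟩
    rw [sinCos_ofReal] at hz
    exact_mod_cast hz

/-! ### The kernel and its partial fraction expansion -/

/-- The ratio of the geometric series of the kernel. -/
def planaRatio (p y : ℝ) : ℝ := Real.exp (-(2 * Real.pi * y)) * ((p - y) / (p + y))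

/-- The kernel of the summation formula of Abel and Plana for the sequence of roots. -/
def planaKernel (p y : ℝ) : ℝ := planaRatio p y / (1 - planaRatio p y)

lemma abs_planaRatio_le {p : ℝ} (hp : 0 < p) {y : ℝ} (hy : 0 ≤ y) :
    |planaRatio p y| ≤ Real.exp (-(2 * Real.pi * y)) := by
  rw [planaRatio, abs_mul, abs_of_pos (Real.exp_pos _)]
  refine mul_le_of_le_one_right (Real.exp_pos _).le ?_
  rw [abs_div, abs_of_pos (by linarith : 0 < p + y)]
  refine div_le_one_of_le₀ (abs_le.2 ⟨?_, ?_⟩) ?_ <;> linarith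

lemma exp_neg_two_pi_lt_one {y : ℝ} (hy : 0 < y) : Real.exp (-(2 * Real.pi * y)) < 1 := by
  have := Real.pi_pos
  exact Real.exp_lt_one_iff.2 (by simp only [neg_lt_zero]; positivity)

lemma abs_planaRatio_lt_one {p : ℝ} (hp : 0 < p) {y : ℝ} (hy : 0 < y) : |planaRatio p y| < 1 :=
  (abs_planaRatio_le hp hy.le).trans_lt (exp_neg_two_pi_lt_one hy)

lemma one_sub_planaRatio_pos {p : ℝ} (hp : 0 < p) {y : ℝ} (hy : 0 < y) :
    0 < 1 - planaRatio p y := by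
  linarith [(abs_lt.1 (abs_planaRatio_lt_one hp hy)).2]

lemma abs_planaKernel_le {p : ℝ} (hp : 0 < p) {y : ℝ} (hy : 0 < y) :
    |planaKernel p y| ≤ Real.exp (-(2 * Real.pi * y)) / (1 - Real.exp (-(2 * Real.pi * y))) := by
  have h1 := abs_planaRatio_le hp hy.le
  have h2 := exp_neg_two_pi_lt_one hy
  have h3 := one_sub_planaRatio_pos hp hy
  rw [planaKernel, abs_div, abs_of_pos h3]
  have := (abs_le.1 h1).2
  exact div_le_div₀ (Real.exp_pos _).le h1 (by linarith) (by linarith)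

lemma hasSum_planaRatio_pow {p : ℝ} (hp : 0 < p) {y : ℝ} (hy : 0 < y) :
    HasSum (fun k : ℕ => planaRatio p y ^ (k + 1)) (planaKernel p y) := by
  have h := (hasSum_geometric_of_abs_lt_one (abs_planaRatio_lt_one hp hy)).mul_left
    (planaRatio p y)
  rw [planaKernel, div_eq_mul_inv]
  exact h.congr_fun fun k => pow_succ' _ _

lemma expQuot_I_mul {p : ℝ} (hp : 0 < p) {y : ℝ} (hy : 0 < y) :
    expQuot p (Complex.I * y) = -(planaRatio p y : ℂ) := by
  have h1 : (p + y : ℂ) ≠ 0 := by exact_mod_cast (add_pos hp hy).ne'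
  have h2 : Complex.I * y - Complex.I * p = -Complex.I * (p - y) := by ring
  have h3 : Complex.I * y + Complex.I * p = Complex.I * (p + y) := by ring
  have h4 : 2 * Real.pi * Complex.I * (Complex.I * y) = -(2 * Real.pi * y) := by
    linear_combination 2 * Real.pi * y * Complex.I_sq
  rw [expQuot, planaRatio, h2, h3, h4]
  push_cast
  field_simp

/-- On the imaginary axis `expQuot` equals -r, so the quotient of `cosSin` by `sinCos` is -i (1 +
r)/(1 - r) = -i (1 + 2K). -/
lemma cosSin_div_I_mul {p : ℝ} (hp : 0 < p) {y : ℝ} (hy : 0 < y) :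
    cosSin p (Complex.I * y) / (sinCos p (Complex.I * y) * (Complex.I * y)) =
      -((1 + 2 * planaKernel p y) / y : ℝ) := by
  have him : 0 ≤ (Complex.I * y).im := by simpa using hy.le
  have h1 : (1 - planaRatio p y : ℂ) ≠ 0 := by exact_mod_cast (one_sub_planaRatio_pos hp hy).ne'
  have h2 : (y : ℂ) ≠ 0 := by exact_mod_cast hy.ne'
  have h3 := div_ne_zero (mul_ne_zero
    (Complex.exp_ne_zero (-(Real.pi * (Complex.I * y) * Complex.I)))
    (add_I_mul_ne_zero hp him)) (two_ne_zero (α := ℂ))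
  rw [sinCos_eq hp him, cosSin_eq hp him, expQuot_I_mul hp hy, planaKernel]
  generalize Complex.exp (-(Real.pi * (Complex.I * y) * Complex.I)) *
    (Complex.I * y + Complex.I * p) / 2 = A at *
  push_cast
  rw [← sub_eq_add_neg]
  field_simp
  ring

/-- The poles ±iy produce the kernel, the pole 0 produces the term with w(0), and each pair of poles
±λ has equal residues. -/
lemma sum_residues {p : ℝ} (hp : 0 < p) {y : ℝ} (hy : 0 < y) {N : ℕ} (hN : 1 ≤ N)
    (hpN : 8 * p ≤ N) (hyN : y < N) :
    (∮ z in C(0, N), cosSin p z / (sinCos p z * (z ^ 2 + y ^ 2))) =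
      2 * Real.pi * Complex.I *
        ((-((1 + 2 * planaKernel p y) / y) + weight p 0 / Real.pi / y ^ 2 +
          2 / Real.pi * ∑ x ∈ (finite_roots_lt hp N).toFinset, weight p x / ((x : ℝ) ^ 2 + y ^ 2)
            : ℝ) : ℂ) := by
  classical
  set S := (finite_roots_lt hp N).toFinset with hS
  have hyc : (y : ℂ) ≠ 0 := by exact_mod_cast hy.ne'
  have hI : Complex.I * y ≠ 0 := mul_ne_zero Complex.I_ne_zero hyc
  set A : Finset ℂ := S.image fun x : roots p => ((x : ℝ) : ℂ) with hA
  set B : Finset ℂ := S.image fun x : roots p => -((x : ℝ) : ℂ) with hB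
  have memA : ∀ z ∈ A, ∃ x : roots p, (x : ℝ) < N ∧ z = (x : ℝ) := by
    intro z hz
    obtain ⟨x, hx, rfl⟩ := Finset.mem_image.1 hz
    exact ⟨x, by simpa [hS] using hx, rfl⟩
  have memB : ∀ z ∈ B, ∃ x : roots p, (x : ℝ) < N ∧ z = -((x : ℝ) : ℂ) := by
    intro z hz
    obtain ⟨x, hx, rfl⟩ := Finset.mem_image.1 hz
    exact ⟨x, by simpa [hS] using hx, rfl⟩
  set T : Finset ℂ := insert (Complex.I * y) (insert (-(Complex.I * y)) (insert 0 (A ∪ B))) with hT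
  have hAB : Disjoint A B := by
    rw [Finset.disjoint_left]
    intro z hz hz'
    obtain ⟨x, -, rfl⟩ := memA z hz
    obtain ⟨x', -, h⟩ := memB _ hz'
    have h' : (x : ℝ) = -x' := by exact_mod_cast h
    linarith [root_pos x, root_pos x']
  have h0 : (0 : ℂ) ∉ A ∪ B := by
    rw [Finset.mem_union]
    rintro (h | h)
    · obtain ⟨x, -, hx⟩ := memA _ h
      exact (root_pos x).ne (by exact_mod_cast hx)
    · obtain ⟨x, -, hx⟩ := memB _ h
      exact (neg_lt_zero.2 (root_pos x)).ne' (by exact_mod_cast hx)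
  have hreal : ∀ z ∈ insert 0 (A ∪ B), ∃ x : ℝ, z = x ∧ sinCos p z = 0 := by
    intro z hz
    rcases Finset.mem_insert.1 hz with rfl | hz
    · exact ⟨0, by simp, by simp [sinCos]⟩
    rcases Finset.mem_union.1 hz with hz | hz
    · obtain ⟨x, -, rfl⟩ := memA z hz
      exact ⟨x, rfl, sinCos_root x⟩
    · obtain ⟨x, -, rfl⟩ := memB z hz
      exact ⟨-x, by simp, by rw [sinCos_neg, sinCos_root, neg_zero]⟩
  have hIm : ∀ z : ℂ, z.im ≠ 0 → z ∉ insert 0 (A ∪ B) := by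
    intro z hz h
    obtain ⟨x, rfl, -⟩ := hreal z h
    simp at hz
  have h1 : -(Complex.I * y) ∉ insert 0 (A ∪ B) := hIm _ (by simpa using hy.ne')
  have h2 : Complex.I * y ∉ insert (-(Complex.I * y)) (insert 0 (A ∪ B)) := by
    rw [Finset.mem_insert, not_or]
    exact ⟨fun h => hI (self_eq_neg.1 h), hIm _ (by simpa using hy.ne')⟩
  have hIsq : (Complex.I * y) ^ 2 + (y : ℂ) ^ 2 = 0 := by
    linear_combination (y : ℂ) ^ 2 * Complex.I_sq
  have hsq : ∀ x : ℝ, (x : ℂ) ^ 2 + (y : ℂ) ^ 2 ≠ 0 := by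
    intro x
    have : x ^ 2 + y ^ 2 ≠ 0 := by positivity
    exact_mod_cast this
  have hDd : ∀ z, HasDerivAt (fun z : ℂ => sinCos p z * (z ^ 2 + (y : ℂ) ^ 2))
      (deriv (sinCos p) z * (z ^ 2 + (y : ℂ) ^ 2) + sinCos p z * (2 * z)) z := by
    intro z
    refine ((differentiable_sinCos p) z).hasDerivAt.mul ?_
    simpa using ((hasDerivAt_id z).pow 2).add_const ((y : ℂ) ^ 2)
  have hfI : sinCos p (Complex.I * y) ≠ 0 := sinCos_ne_zero_of_im_pos hp (by simpa using hy)
  have hres : ∀ x : ℝ, sinCos p x = 0 →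
      deriv (fun z : ℂ => sinCos p z * (z ^ 2 + (y : ℂ) ^ 2)) x ≠ 0 ∧
      cosSin p x / deriv (fun z : ℂ => sinCos p z * (z ^ 2 + (y : ℂ) ^ 2)) x =
        (weight p x / Real.pi / (x ^ 2 + y ^ 2) : ℝ) := by
    intro x hx
    obtain ⟨h3, h4⟩ := residue_at_real_zero hp hx
    rw [(hDd x).deriv, hx, zero_mul, add_zero]
    refine ⟨mul_ne_zero h3 (hsq x), ?_⟩
    rw [← div_div, h4]
    push_cast
    rfl
  have hker := circleIntegral_div_eq_sum (N := cosSin p)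
    (D := fun z : ℂ => sinCos p z * (z ^ 2 + (y : ℂ) ^ 2))
    (differentiable_cosSin p) (fun z => (hDd z).differentiableAt) (R := N) (by positivity) T
    (by
      intro z hz
      rw [Metric.mem_ball, dist_zero_right]
      simp only [hT, Finset.mem_insert, Finset.mem_union] at hz
      rcases hz with rfl | rfl | rfl | hz | hz
      · simpa [abs_of_pos hy] using hyN
      · simpa [abs_of_pos hy] using hyN
      · simpa using Nat.pos_of_ne_zero (by omega)
      · obtain ⟨x, hx, rfl⟩ := memA z hz
        simpa [abs_of_pos (root_pos x)] using hx
      · obtain ⟨x, hx, rfl⟩ := memB z hz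
        simpa [abs_of_pos (root_pos x)] using hx)
    (by
      intro z hz
      rw [Metric.mem_closedBall, dist_zero_right] at hz
      constructor
      · intro h
        rcases mul_eq_zero.1 h with h | h
        · have hlt : ‖z‖ < N := lt_of_le_of_ne hz fun h' =>
            (norm_cosSin_le hp hN hpN h').1 h
          rcases eq_root_of_sinCos_eq_zero hp h with rfl | ⟨x, rfl | rfl⟩
          · simp [hT]
          · have : x ∈ S := by simpa [hS, abs_of_pos (root_pos x)] using hlt
            simp only [hT, Finset.mem_insert, Finset.mem_union]
            exact Or.inr (Or.inr (Or.inr (Or.inl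
              (Finset.mem_image_of_mem (fun x : roots p => ((x : ℝ) : ℂ)) this))))
          · have : x ∈ S := by simpa [hS, abs_of_pos (root_pos x)] using hlt
            simp only [hT, Finset.mem_insert, Finset.mem_union]
            exact Or.inr (Or.inr (Or.inr (Or.inr
              (Finset.mem_image_of_mem (fun x : roots p => -((x : ℝ) : ℂ)) this))))
        · have : (z - Complex.I * y) * (z + Complex.I * y) = 0 := by
            linear_combination h - (y : ℂ) ^ 2 * Complex.I_sq
          rcases mul_eq_zero.1 this with h | h
          · simp [hT, sub_eq_zero.1 h]
          · simp [hT, eq_neg_of_add_eq_zero_left h]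
      · intro h
        rw [hT, Finset.mem_insert, Finset.mem_insert] at h
        rcases h with rfl | rfl | h
        · simp only [hIsq, mul_zero]
        · simp only [neg_sq, hIsq, mul_zero]
        · obtain ⟨x, -, h⟩ := hreal z h
          simp only [h, zero_mul])
    (by
      intro z hz
      rw [hT, Finset.mem_insert, Finset.mem_insert] at hz
      rcases hz with rfl | rfl | h
      · rw [(hDd _).deriv, hIsq, mul_zero, zero_add]
        exact mul_ne_zero hfI (mul_ne_zero two_ne_zero hI)
      · rw [(hDd _).deriv, neg_sq, hIsq, mul_zero, zero_add, sinCos_neg]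
        exact mul_ne_zero (neg_ne_zero.2 hfI) (mul_ne_zero two_ne_zero (neg_ne_zero.2 hI))
      · obtain ⟨x, rfl, h⟩ := hreal z h
        exact (hres x h).1)
  rw [hker, hT, Finset.sum_insert h2, Finset.sum_insert h1, Finset.sum_insert h0,
    Finset.sum_union hAB, Finset.sum_image (by simp), Finset.sum_image (by simp)]
  congr 1
  -- The factor 1/2 arises because z² + y² has derivative 2iy at iy.
  have e1 : cosSin p (Complex.I * y) / deriv (fun z : ℂ => sinCos p z * (z ^ 2 + (y : ℂ) ^ 2))
      (Complex.I * y) = -((1 + 2 * planaKernel p y) / y : ℝ) / 2 := by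
    rw [← cosSin_div_I_mul hp hy, (hDd _).deriv, hIsq, mul_zero, zero_add]
    field_simp
  have e2 : cosSin p (-(Complex.I * y)) / deriv (fun z : ℂ => sinCos p z * (z ^ 2 + (y : ℂ) ^ 2))
      (-(Complex.I * y)) = -((1 + 2 * planaKernel p y) / y : ℝ) / 2 := by
    rw [← cosSin_div_I_mul hp hy, (hDd _).deriv, neg_sq, hIsq, mul_zero, zero_add, sinCos_neg,
      cosSin_neg]
    field_simp
  have e3 : cosSin p 0 / deriv (fun z : ℂ => sinCos p z * (z ^ 2 + (y : ℂ) ^ 2)) 0 =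
      (weight p 0 / Real.pi / y ^ 2 : ℝ) := by
    have := (hres 0 (by simp [sinCos])).2
    simpa using this
  have e4 : ∀ x : roots p, cosSin p (x : ℝ) /
      deriv (fun z : ℂ => sinCos p z * (z ^ 2 + (y : ℂ) ^ 2)) (x : ℝ) =
        (weight p x / Real.pi / ((x : ℝ) ^ 2 + y ^ 2) : ℝ) :=
    fun x => (hres x (sinCos_root x)).2
  have e5 : ∀ x : roots p, cosSin p (-((x : ℝ) : ℂ)) /
      deriv (fun z : ℂ => sinCos p z * (z ^ 2 + (y : ℂ) ^ 2)) (-((x : ℝ) : ℂ)) =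
        (weight p x / Real.pi / ((x : ℝ) ^ 2 + y ^ 2) : ℝ) := by
    intro x
    have := (hres (-x) (by rw [Complex.ofReal_neg, sinCos_neg, sinCos_root, neg_zero])).2
    rw [Complex.ofReal_neg] at this
    rw [this]
    simp [weight]
  rw [e1, e2, e3, Finset.sum_congr rfl fun x _ => e4 x, Finset.sum_congr rfl fun x _ => e5 x,
    ← Complex.ofReal_sum]
  have : ∀ x : roots p, weight p x / Real.pi / ((x : ℝ) ^ 2 + y ^ 2) =
      1 / Real.pi * (weight p x / ((x : ℝ) ^ 2 + y ^ 2)) := fun x => by ring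
  simp only [this]
  rw [← Finset.mul_sum]
  push_cast
  ring

lemma summable_weight_div {p : ℝ} (hp : 0 < p) (y : ℝ) :
    Summable fun x : roots p => weight p x / ((x : ℝ) ^ 2 + y ^ 2) := by
  have h : ∀ x : roots p, 0 < (x : ℝ) ^ 2 := fun x => pow_pos (root_pos x) 2
  refine Summable.of_nonneg_of_le (fun x => ?_) (fun x => ?_) (summable_root_inv_sq hp)
  · exact div_nonneg (weight_pos hp x).le (by positivity)
  · exact div_le_div₀ zero_le_one (weight_le_one hp x) (h x) (by nlinarith [sq_nonneg y])

/-- The kernel with its limits at infinity and its pole at the origin removed. -/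
def reducedKernel (p y : ℝ) : ℝ := 1 + 2 * planaKernel p y - weight p 0 / (Real.pi * y)

/-- The integrand is O(1/N²) on a circle of length 2πN, so the residue sums F N tend to 0. Their
limit is also the full series with the kernel terms, and solving for the series gives the expansion.
-/
lemma hasSum_reducedKernel {p : ℝ} (hp : 0 < p) {y : ℝ} (hy : 0 < y) :
    HasSum (fun x : roots p => 2 / Real.pi * (weight p x * (y / ((x : ℝ) ^ 2 + y ^ 2))))
      (reducedKernel p y) := by
  set F : ℕ → ℝ := fun N =>
    -((1 + 2 * planaKernel p y) / y) + weight p 0 / Real.pi / y ^ 2 +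
      2 / Real.pi * ∑ x ∈ (finite_roots_lt hp N).toFinset, weight p x / ((x : ℝ) ^ 2 + y ^ 2)
    with hF
  have hS : Tendsto (fun N : ℕ => (finite_roots_lt hp N).toFinset) atTop atTop := by
    refine tendsto_atTop_finset_of_monotone (fun a b hab x hx => ?_) fun x => ?_
    · simp only [Finite.mem_toFinset, mem_ofPred_eq] at hx ⊢
      exact hx.trans_le (by exact_mod_cast hab)
    · obtain ⟨n, hn⟩ := exists_nat_gt (x : ℝ)
      exact ⟨n, by simpa using hn⟩
  have hlim : Tendsto F atTop (𝓝 (-((1 + 2 * planaKernel p y) / y) + weight p 0 / Real.pi / y ^ 2 +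
      2 / Real.pi * ∑' x : roots p, weight p x / ((x : ℝ) ^ 2 + y ^ 2))) :=
    (((summable_weight_div hp y).hasSum.comp hS).const_mul _).const_add _
  have hzero : Tendsto F atTop (𝓝 0) := by
    have hb : ∀ᶠ N : ℕ in atTop, ‖F N‖ ≤ 4 * N / ((N : ℝ) ^ 2 - y ^ 2) := by
      filter_upwards [eventually_ge_atTop 1, eventually_ge_atTop ⌈8 * p⌉₊,
        eventually_gt_atTop ⌈y⌉₊] with N hN hpN hyN
      have hpN' : 8 * p ≤ N := (Nat.le_ceil _).trans (by exact_mod_cast hpN)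
      have hyN' : y < N := (Nat.le_ceil _).trans_lt (by exact_mod_cast hyN)
      have hN0 : (0 : ℝ) < N := by exact_mod_cast hN
      have hpos : 0 < (N : ℝ) ^ 2 - y ^ 2 := by nlinarith
      have h1 := sum_residues hp hy hN hpN' hyN'
      have h2 := circleIntegral.norm_integral_le_of_norm_le_const (c := (0 : ℂ)) (R := N)
        (f := fun z => cosSin p z / (sinCos p z * (z ^ 2 + y ^ 2)))
        (C := 4 / ((N : ℝ) ^ 2 - y ^ 2)) hN0.le (by
          intro z hz
          rw [mem_sphere_zero_iff_norm] at hz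
          obtain ⟨h3, h4⟩ := norm_cosSin_le hp hN hpN' hz
          have h5 : (N : ℝ) ^ 2 - y ^ 2 ≤ ‖z ^ 2 + (y : ℂ) ^ 2‖ := by
            have := norm_sub_le (z ^ 2 + (y : ℂ) ^ 2) ((y : ℂ) ^ 2)
            rw [add_sub_cancel_right, norm_pow, norm_pow, hz, Complex.norm_real,
              Real.norm_eq_abs, sq_abs] at this
            linarith
          rw [norm_div, norm_mul, ← div_div]
          refine div_le_div₀ (by norm_num) ?_ hpos h5
          exact div_le_of_le_mul₀ (norm_nonneg _) (by norm_num) h4)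
      rw [h1, norm_mul, Complex.norm_real] at h2
      have h3 : ‖(2 * Real.pi * Complex.I : ℂ)‖ = 2 * Real.pi := by
        simp [abs_of_pos Real.pi_pos]
      rw [h3, mul_assoc (2 * Real.pi)] at h2
      have h4 := le_of_mul_le_mul_left h2 Real.two_pi_pos
      refine h4.trans_eq ?_
      ring
    refine squeeze_zero_norm' hb ?_
    have h1 : Tendsto (fun N : ℕ => (N : ℝ)) atTop atTop := tendsto_natCast_atTop_atTop
    have h2 : Tendsto (fun N : ℕ => 4 / ((N : ℝ) - y ^ 2 / N)) atTop (𝓝 0) := by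
      refine Tendsto.div_atTop tendsto_const_nhds ?_
      simp only [sub_eq_add_neg]
      exact h1.atTop_add ((h1.const_div_atTop (y ^ 2)).neg)
    refine h2.congr' ?_
    filter_upwards [eventually_ge_atTop 1] with N hN
    have : (N : ℝ) ≠ 0 := by positivity
    field_simp
  have heq := tendsto_nhds_unique hlim hzero
  have hs := (summable_weight_div hp y).hasSum.mul_left (2 * y / Real.pi)
  have hval : reducedKernel p y =
      2 * y / Real.pi * ∑' x : roots p, weight p x / ((x : ℝ) ^ 2 + y ^ 2) := by
    rw [reducedKernel]
    have := Real.pi_pos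
    field_simp at heq ⊢
    linarith
  rw [hval]
  exact hs.congr_fun fun x => by ring

/-! ### The second zeta function as a Mellin transform -/

lemma norm_bracketIntegrand_le (s : ℂ) {a : ℝ} (ha : 0 ≤ a) (k : ℕ) {x : ℝ} (hx : 0 < x) :
    ‖bracketIntegrand s a k x‖ ≤ Real.exp (-x) * x ^ (s.re - 1) := by
  rw [bracketIntegrand, norm_mul, Complex.norm_real, Complex.norm_cpow_eq_rpow_re_of_pos hx,
    Complex.sub_re, Complex.one_re, norm_mul, Real.norm_of_nonneg (Real.exp_pos _).le, norm_pow]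
  refine mul_le_mul_of_nonneg_right ?_ (Real.rpow_nonneg hx.le _)
  refine mul_le_of_le_one_right (Real.exp_pos _).le (pow_le_one₀ (norm_nonneg _) ?_)
  rw [Real.norm_eq_abs, abs_div, abs_of_pos (by linarith : 0 < a + x)]
  refine div_le_one_of_le₀ (abs_le.2 ⟨?_, ?_⟩) ?_ <;> linarith

lemma integrableOn_bracketIntegrand {s : ℂ} (hs : 0 < s.re) {a : ℝ} (ha : 0 ≤ a) (k : ℕ) :
    IntegrableOn (bracketIntegrand s a k) (Ioi 0) := by
  refine Integrable.mono' (Real.GammaIntegral_convergent hs) ?_ ?_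
  · apply Measurable.aestronglyMeasurable
    unfold bracketIntegrand
    fun_prop
  · filter_upwards [ae_restrict_mem measurableSet_Ioi] with x hx
    exact norm_bracketIntegrand_le s ha k hx

/-- The scaling x = 2πky frees the rational factor from k, so that the integrand becomes the k-th
power of one ratio; the power of k it produces cancels k^s in the series of η. -/
lemma bracketIntegrand_comp_mul (p : ℝ) (s : ℂ) {k : ℕ} (hk : 0 < k) {y : ℝ} (hy : 0 < y) :
    bracketIntegrand s (2 * Real.pi * p * k) k ((2 * Real.pi * k) * y) =
      ((2 * Real.pi * k : ℝ) : ℂ) ^ (s - 1) *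
        ((y : ℂ) ^ (s - 1) * ((planaRatio p y ^ k : ℝ) : ℂ)) := by
  have hk' : (0 : ℝ) < k := by exact_mod_cast hk
  have hpi := Real.pi_pos
  have h1 : (2 * Real.pi * p * k - 2 * Real.pi * k * y) / (2 * Real.pi * p * k + 2 * Real.pi * k * y)
      = (p - y) / (p + y) := by
    rw [show 2 * Real.pi * p * k - 2 * Real.pi * k * y = (2 * Real.pi * k) * (p - y) by ring,
      show 2 * Real.pi * p * k + 2 * Real.pi * k * y = (2 * Real.pi * k) * (p + y) by ring,
      mul_div_mul_left _ _ (by positivity)]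
  have h2 : Real.exp (-(2 * Real.pi * k * y)) = Real.exp (-(2 * Real.pi * y)) ^ k := by
    rw [← Real.exp_nat_mul]; ring_nf
  rw [bracketIntegrand, h1, h2, ← mul_pow, ← planaRatio, Complex.ofReal_mul (2 * Real.pi * k) y,
    Complex.mul_cpow_ofReal_nonneg (by positivity) hy.le]
  ring

lemma etaTerm_eq (p : ℝ) {s : ℂ} (hs : 0 < s.re) {k : ℕ} (hk : 0 < k) :
    etaTerm p s k = (2 * Real.pi : ℂ) ^ s / Complex.Gamma s *
      ∫ y in Ioi (0 : ℝ), (y : ℂ) ^ (s - 1) * ((planaRatio p y ^ k : ℝ) : ℂ) := by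
  have hk' : (0 : ℝ) < k := by exact_mod_cast hk
  have hpi := Real.pi_pos
  have hb : 0 < 2 * Real.pi * k := by positivity
  have h1 := integral_comp_mul_left_Ioi (bracketIntegrand s (2 * Real.pi * p * k) k) 0 hb
  rw [setIntegral_congr_fun measurableSet_Ioi
    (fun y hy => bracketIntegrand_comp_mul p s hk hy), mul_zero, integral_const_mul] at h1
  have hbc : ((2 * Real.pi * k : ℝ) : ℂ) ≠ 0 := by exact_mod_cast hb.ne'
  have hkc : (k : ℂ) ≠ 0 := by exact_mod_cast hk.ne'
  have h2 : ∫ x in Ioi (0 : ℝ), bracketIntegrand s (2 * Real.pi * p * k) k x =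
      ((2 * Real.pi * k : ℝ) : ℂ) ^ s *
        ∫ y in Ioi (0 : ℝ), (y : ℂ) ^ (s - 1) * ((planaRatio p y ^ k : ℝ) : ℂ) := by
    rw [Complex.cpow_sub _ _ hbc, Complex.cpow_one, Complex.real_smul] at h1
    push_cast at h1 hbc ⊢
    field_simp at h1
    exact h1.symm
  have h3 : ((2 * Real.pi * k : ℝ) : ℂ) ^ s = (2 * Real.pi : ℂ) ^ s * (k : ℂ) ^ s := by
    rw [Complex.ofReal_mul, Complex.mul_cpow_ofReal_nonneg (by positivity) hk'.le]
    push_cast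
    rfl
  have h4 : (k : ℂ) ^ s ≠ 0 := by
    rw [Complex.cpow_def_of_ne_zero (by exact_mod_cast hk.ne')]
    exact Complex.exp_ne_zero _
  have h5 := Complex.Gamma_ne_zero_of_re_pos hs
  rw [etaTerm, bracket, h2, h3]
  field_simp

lemma norm_planaRatio_pow_le {p : ℝ} (hp : 0 < p) (s : ℂ) (k : ℕ) {y : ℝ} (hy : 0 < y) :
    ‖(y : ℂ) ^ (s - 1) * ((planaRatio p y ^ k : ℝ) : ℂ)‖ ≤
      y ^ (s.re - 1) * Real.exp (-((2 * Real.pi * k) * y)) := by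
  rw [norm_mul, Complex.norm_real, Complex.norm_cpow_eq_rpow_re_of_pos hy,
    Complex.sub_re, Complex.one_re, norm_pow]
  refine mul_le_mul_of_nonneg_left ?_ (Real.rpow_nonneg hy.le _)
  refine (pow_le_pow_left₀ (norm_nonneg _) (abs_planaRatio_le hp hy.le) k).trans_eq ?_
  rw [← Real.exp_nat_mul]
  ring_nf

lemma integrableOn_rpow_mul_exp_neg {a b : ℝ} (ha : 0 < a) (hb : 0 < b) :
    IntegrableOn (fun y : ℝ => y ^ (a - 1) * Real.exp (-(b * y))) (Ioi 0) := by
  have := integrableOn_rpow_mul_exp_neg_mul_rpow (p := 1) (s := a - 1) (b := b) (by linarith)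
    one_pos hb
  simpa using this

lemma measurable_planaRatio (p : ℝ) : Measurable (planaRatio p) := by
  unfold planaRatio
  fun_prop

lemma measurable_planaKernel (p : ℝ) : Measurable (planaKernel p) :=
  (measurable_planaRatio p).div (measurable_const.sub (measurable_planaRatio p))

/-- The integral of the norm of the k-th power is at most Γ(Re s) (2πk)^{-Re s}, summable for Re s >
1. This permits summing the geometric series under the integral. -/
lemma hasSum_etaTerm {p : ℝ} (hp : 0 < p) {s : ℂ} (hs : 1 < s.re) :
    HasSum (fun k : ℕ => etaTerm p s (k + 1)) ((2 * Real.pi : ℂ) ^ s / Complex.Gamma s *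
      mellin (fun y => (planaKernel p y : ℂ)) s) := by
  have hs0 : 0 < s.re := by linarith
  have hpi := Real.pi_pos
  set F : ℕ → ℝ → ℂ := fun k y => (y : ℂ) ^ (s - 1) * ((planaRatio p y ^ (k + 1) : ℝ) : ℂ)
  have hb : ∀ k : ℕ, 0 < 2 * Real.pi * ((k + 1 : ℕ) : ℝ) := fun k => by positivity
  have hint : ∀ k, IntegrableOn (F k) (Ioi 0) := by
    intro k
    refine Integrable.mono' (integrableOn_rpow_mul_exp_neg hs0 (hb k)) ?_ ?_
    · apply Measurable.aestronglyMeasurable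
      have := measurable_planaRatio p
      fun_prop
    · filter_upwards [ae_restrict_mem measurableSet_Ioi] with y hy
      exact norm_planaRatio_pow_le hp s (k + 1) hy
  have hsum : Summable fun k => ∫ y in Ioi (0 : ℝ), ‖F k y‖ := by
    have h1 : Summable fun k : ℕ => (1 / (2 * Real.pi)) ^ s.re * Real.Gamma s.re *
        ((k + 1 : ℕ) : ℝ) ^ (-s.re) :=
      ((summable_nat_add_iff 1).2 (Real.summable_nat_rpow.2 (by linarith))).mul_left _
    refine Summable.of_nonneg_of_le (fun k => integral_nonneg fun y => norm_nonneg _)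
      (fun k => ?_) h1
    calc ∫ y in Ioi (0 : ℝ), ‖F k y‖
        ≤ ∫ y in Ioi (0 : ℝ), y ^ (s.re - 1) * Real.exp (-((2 * Real.pi * (k + 1 : ℕ)) * y)) :=
          setIntegral_mono_on (hint k).norm (integrableOn_rpow_mul_exp_neg hs0 (hb k))
            measurableSet_Ioi fun y hy => norm_planaRatio_pow_le hp s (k + 1) hy
      _ = (1 / (2 * Real.pi * (k + 1 : ℕ))) ^ s.re * Real.Gamma s.re :=
          Real.integral_rpow_mul_exp_neg_mul_Ioi hs0 (hb k)
      _ = _ := by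
          rw [← div_div, Real.div_rpow (by positivity) (by positivity),
            Real.rpow_neg (by positivity)]
          ring
  have h := hasSum_integral_of_summable_integral_norm hint hsum
  have htsum : ∫ y in Ioi (0 : ℝ), ∑' k, F k y = mellin (fun y => (planaKernel p y : ℂ)) s := by
    rw [mellin]
    refine setIntegral_congr_fun measurableSet_Ioi fun y hy => ?_
    exact ((Complex.hasSum_ofReal.2 (hasSum_planaRatio_pow hp hy)).mul_left _).tsum_eq
  rw [htsum] at h
  refine (h.mul_left ((2 * Real.pi : ℂ) ^ s / Complex.Gamma s)).congr_fun fun k => ?_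
  exact etaTerm_eq p hs0 k.succ_pos

lemma eta_eq_mellin {p : ℝ} (hp : 0 < p) {s : ℂ} (hs : 1 < s.re) :
    eta p s = (2 * Real.pi : ℂ) ^ s / Complex.Gamma s *
      mellin (fun y => (planaKernel p y : ℂ)) s :=
  (hasSum_etaTerm hp hs).tsum_eq

/-! ### Mellin transforms of rational functions -/

/-- Writing 1/(1 + u) = ∫ e^{-x(1+u)} dx and exchanging the integrals gives Γ(a) Γ(1 - a). -/
lemma hasMellin_one_div_one_add {a : ℂ} (h0 : 0 < a.re) (h1 : a.re < 1) :
    HasMellin (fun u : ℝ => ((1 / (1 + u) : ℝ) : ℂ)) a (Real.pi / Complex.sin (Real.pi * a)) := by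
  set f : ℝ → ℝ → ℂ := fun x u => (u : ℂ) ^ (a - 1) * ((Real.exp (-(x * (1 + u))) : ℝ) : ℂ)
  have hnorm : ∀ x, ∀ u ∈ Ioi (0 : ℝ), ‖f x u‖ =
      Real.exp (-x) * (u ^ (a.re - 1) * Real.exp (-(x * u))) := by
    intro x u hu
    rw [norm_mul, Complex.norm_real, Complex.norm_cpow_eq_rpow_re_of_pos hu, Complex.sub_re,
      Complex.one_re, Real.norm_of_nonneg (Real.exp_pos _).le, mul_add, mul_one, neg_add,
      Real.exp_add]
    ring
  have hinner : ∀ x ∈ Ioi (0 : ℝ), ∫ u in Ioi (0 : ℝ), ‖f x u‖ =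
      Real.Gamma a.re * (Real.exp (-x) * x ^ ((1 - a.re) - 1)) := by
    intro x hx
    have hx' : (0 : ℝ) < x := hx
    rw [setIntegral_congr_fun measurableSet_Ioi (hnorm x), integral_const_mul,
      Real.integral_rpow_mul_exp_neg_mul_Ioi h0 hx, one_div, Real.inv_rpow hx'.le,
      ← Real.rpow_neg hx'.le, show 1 - a.re - 1 = -a.re by ring]
    ring
  have hmeas : Measurable (Function.uncurry f) := by
    simp only [f, Function.uncurry_def]
    fun_prop
  have hint : Integrable (Function.uncurry f)
      ((volume.restrict (Ioi 0)).prod (volume.restrict (Ioi 0))) := by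
    rw [integrable_prod_iff hmeas.aestronglyMeasurable]
    constructor
    · filter_upwards [ae_restrict_mem measurableSet_Ioi] with x hx
      refine Integrable.mono' ((integrableOn_rpow_mul_exp_neg h0 hx).const_mul (Real.exp (-x)))
        (hmeas.comp (measurable_const.prodMk measurable_id)).aestronglyMeasurable ?_
      filter_upwards [ae_restrict_mem measurableSet_Ioi] with u hu
      exact (hnorm x u hu).le
    · refine (IntegrableOn.congr_fun ((Real.GammaIntegral_convergent
        (by linarith : 0 < 1 - a.re)).const_mul (Real.Gamma a.re)) (fun x hx => ?_)
        measurableSet_Ioi)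
      exact (hinner x hx).symm
  have hswap := integral_integral_swap hint
  have hx : ∀ u ∈ Ioi (0 : ℝ), ∫ x in Ioi (0 : ℝ), f x u =
      (u : ℂ) ^ (a - 1) • ((1 / (1 + u) : ℝ) : ℂ) := by
    intro u hu
    have hu' : (0 : ℝ) < 1 + u := by linarith [mem_Ioi.1 hu]
    rw [integral_const_mul, smul_eq_mul]
    congr 1
    rw [integral_complex_ofReal]
    congr 1
    have := integral_exp_mul_Ioi (a := -(1 + u)) (by linarith) 0
    rw [mul_zero, Real.exp_zero, neg_div_neg_eq] at this
    rw [← this]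
    exact integral_congr_ae (ae_of_all _ fun x => by ring_nf)
  have hu : ∀ x ∈ Ioi (0 : ℝ), ∫ u in Ioi (0 : ℝ), f x u =
      Complex.Gamma a * (((Real.exp (-x) : ℝ) : ℂ) * (x : ℂ) ^ ((1 - a) - 1)) := by
    intro x hx
    have hx' : (0 : ℝ) < x := hx
    have h2 : ∀ u : ℝ, f x u = ((Real.exp (-x) : ℝ) : ℂ) *
        ((u : ℂ) ^ (a - 1) * Complex.exp (-(x * u))) := by
      intro u
      simp only [f]
      rw [mul_add, mul_one, neg_add, Real.exp_add]
      push_cast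
      ring
    simp only [h2]
    rw [integral_const_mul, Complex.integral_cpow_mul_exp_neg_mul_Ioi h0 hx', one_div,
      ← Complex.ofReal_inv, Complex.ofReal_inv, Complex.inv_cpow, ← Complex.cpow_neg,
      show 1 - a - 1 = -a by ring]
    · ring
    · rw [Complex.arg_ofReal_of_nonneg hx'.le]
      exact Real.pi_pos.ne
  rw [setIntegral_congr_fun measurableSet_Ioi hu, setIntegral_congr_fun measurableSet_Ioi hx,
    integral_const_mul] at hswap
  refine ⟨?_, ?_⟩
  · refine IntegrableOn.congr_fun hint.integral_prod_right hx measurableSet_Ioi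
  · rw [mellin, ← hswap, ← Complex.Gamma_mul_Gamma_one_sub,
      Complex.Gamma_eq_integral (by simpa using h1 : 0 < (1 - a).re), Complex.GammaIntegral]

/-- With y = lv and u = v² this is the preceding transform at a = (s + 1)/2, where sin(πa) =
cos(πs/2). -/
lemma hasMellin_div_sq_add_sq {l : ℝ} (hl : 0 < l) {s : ℂ} (h0 : -1 < s.re) (h1 : s.re < 1) :
    HasMellin (fun y : ℝ => ((y / (l ^ 2 + y ^ 2) : ℝ) : ℂ)) s
      (Real.pi / 2 / Complex.cos (Real.pi * s / 2) * (l : ℂ) ^ (s - 1)) := by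
  have hre : ((s + 1) / ((2 : ℝ) : ℂ)).re = (s.re + 1) / 2 := by
    rw [Complex.div_ofReal_re]; simp
  obtain ⟨hc, hv⟩ := hasMellin_one_div_one_add (a := (s + 1) / ((2 : ℝ) : ℂ))
    (by rw [hre]; linarith) (by rw [hre]; linarith)
  set F : ℝ → ℂ := fun u => ((1 / (1 + u) : ℝ) : ℂ)
  set G : ℝ → ℂ := fun v => (v : ℂ) ^ (1 : ℂ) • F (v ^ (2 : ℝ))
  have hGc : MellinConvergent G s :=
    MellinConvergent.cpow_smul.2 ((MellinConvergent.comp_rpow two_ne_zero).2 hc)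
  have hGv : mellin G s = Real.pi / 2 / Complex.cos (Real.pi * s / 2) := by
    have h2 : Complex.sin (Real.pi * ((s + 1) / ((2 : ℝ) : ℂ))) =
        Complex.cos (Real.pi * s / 2) := by
      rw [← Complex.sin_add_pi_div_two]
      push_cast
      ring_nf
    have h3 : mellin G s = mellin (fun v : ℝ => F (v ^ (2 : ℝ))) (s + 1) := mellin_cpow_smul _ _ _
    rw [h3, mellin_comp_rpow, hv, h2, Complex.real_smul]
    norm_num
    ring
  have hlc : (l : ℂ) ≠ 0 := by exact_mod_cast hl.ne'
  have hl' : 0 < l⁻¹ := inv_pos.2 hl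
  have heq : (fun y : ℝ => ((y / (l ^ 2 + y ^ 2) : ℝ) : ℂ)) =
      fun y : ℝ => (l : ℂ)⁻¹ • G (l⁻¹ * y) := by
    funext y
    have h2 : (1 + (l⁻¹ * y) ^ 2 : ℝ) ≠ 0 := by positivity
    have h3 : (l ^ 2 + y ^ 2 : ℝ) ≠ 0 := by positivity
    have h4 : y / (l ^ 2 + y ^ 2) = l⁻¹ * (l⁻¹ * y * (1 / (1 + (l⁻¹ * y) ^ 2))) := by
      field_simp
    simp only [G, F, Complex.cpow_one, Real.rpow_two, smul_eq_mul]
    rw [h4]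
    push_cast
    rfl
  rw [heq]
  refine ⟨((MellinConvergent.comp_mul_left hl').2 hGc).const_smul _, ?_⟩
  rw [mellin_const_smul, mellin_comp_mul_left G s hl', hGv, smul_eq_mul, smul_eq_mul,
    Complex.cpow_sub _ _ hlc, Complex.cpow_one, Complex.ofReal_inv, Complex.inv_cpow,
    Complex.cpow_neg, inv_inv]
  · ring
  · rw [Complex.arg_ofReal_of_nonneg hl.le]
    exact Real.pi_pos.ne

lemma cos_pi_mul_div_two_ne_zero {s : ℂ} (h0 : -1 < s.re) (h1 : s.re < 1) :
    Complex.cos (Real.pi * s / 2) ≠ 0 := by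
  rw [Complex.cos_ne_zero_iff]
  intro k hk
  have hpi : (Real.pi : ℂ) ≠ 0 := by exact_mod_cast Real.pi_ne_zero
  have h2 : s = ((2 * k + 1 : ℤ) : ℂ) := by
    push_cast
    field_simp at hk
    linear_combination hk
  rw [h2, Complex.intCast_re] at h0 h1
  have h3 : (-1 : ℤ) < 2 * k + 1 := by exact_mod_cast h0
  have h4 : 2 * k + 1 < (1 : ℤ) := by exact_mod_cast h1
  omega

lemma norm_mellin_integrand {f : ℝ → ℝ} {y : ℝ} (s : ℂ) (hy : 0 < y) (hf : 0 ≤ f y) :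
    ‖(y : ℂ) ^ (s - 1) • ((f y : ℝ) : ℂ)‖ = y ^ (s.re - 1) * f y := by
  rw [norm_smul, Complex.norm_cpow_eq_rpow_re_of_pos hy, Complex.norm_real, Complex.sub_re,
    Complex.one_re, Real.norm_of_nonneg hf]

/-- Only Re s enters |y^{s-1}|, so this is the transform at a real point. The power of l decides
summability over the roots. -/
lemma integral_norm_mellin_integrand {l : ℝ} (hl : 0 < l) {s : ℂ} (h0 : -1 < s.re)
    (h1 : s.re < 1) :
    ∫ y in Ioi (0 : ℝ), ‖(y : ℂ) ^ (s - 1) • ((y / (l ^ 2 + y ^ 2) : ℝ) : ℂ)‖ =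
      ‖Real.pi / 2 / Complex.cos (Real.pi * s.re / 2)‖ * l ^ (s.re - 1) := by
  have h := (hasMellin_div_sq_add_sq hl (s := (s.re : ℂ)) (by simpa) (by simpa)).2
  have hpos : ∀ y ∈ Ioi (0 : ℝ), 0 ≤ y / (l ^ 2 + y ^ 2) := fun y hy =>
    div_nonneg (le_of_lt hy) (by positivity)
  have h2 : mellin (fun y : ℝ => ((y / (l ^ 2 + y ^ 2) : ℝ) : ℂ)) (s.re : ℂ) =
      ((∫ y in Ioi (0 : ℝ), y ^ (s.re - 1) * (y / (l ^ 2 + y ^ 2)) : ℝ) : ℂ) := by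
    rw [mellin, ← integral_complex_ofReal]
    refine setIntegral_congr_fun measurableSet_Ioi fun y hy => ?_
    simp only [smul_eq_mul]
    rw [Complex.ofReal_mul, Complex.ofReal_cpow (le_of_lt hy)]
    push_cast
    rfl
  rw [setIntegral_congr_fun measurableSet_Ioi fun y hy =>
    norm_mellin_integrand (f := fun y => y / (l ^ 2 + y ^ 2)) s hy (hpos y hy)]
  have h3 : 0 ≤ ∫ y in Ioi (0 : ℝ), y ^ (s.re - 1) * (y / (l ^ 2 + y ^ 2)) :=
    setIntegral_nonneg measurableSet_Ioi fun y hy =>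
      mul_nonneg (Real.rpow_nonneg (le_of_lt hy) _) (hpos y hy)
  rw [← Real.norm_of_nonneg h3, ← Complex.norm_real, ← h2, h, norm_mul,
    Complex.norm_cpow_eq_rpow_re_of_pos hl]
  simp

/-- In the strip `-1 < Re s < 0` the Dirichlet series at `1 - s` is a Mellin transform. -/
lemma hasSum_zetaTerm_mellin {p : ℝ} (hp : 0 < p) {s : ℂ} (h0 : -1 < s.re) (h1 : s.re < 0) :
    HasSum (zetaTerm p (1 - s)) (Complex.cos (Real.pi * s / 2) *
      mellin (fun y => (reducedKernel p y : ℂ)) s) := by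
  have := countable_roots hp
  have h1' : s.re < 1 := by linarith
  set F : roots p → ℝ → ℂ := fun x y => (2 / Real.pi * weight p x : ℝ) *
    ((y : ℂ) ^ (s - 1) • ((y / ((x : ℝ) ^ 2 + y ^ 2) : ℝ) : ℂ)) with hF
  have hint : ∀ x, IntegrableOn (F x) (Ioi 0) := fun x =>
    ((hasMellin_div_sq_add_sq (root_pos x) h0 h1').1).const_mul _
  have hpi := Real.pi_pos
  -- The norms are proportional to w(λ) λ^{Re s - 1}, summable because Re s < 0.
  have hsum : Summable fun x => ∫ y in Ioi (0 : ℝ), ‖F x y‖ := by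
    have h2 := (summable_weight_mul hp (fun x : roots p => Real.rpow_nonneg (root_pos x).le _)
      (summable_root_rpow hp (by linarith : 1 < 1 - s.re))).mul_left
        (2 / Real.pi * ‖Real.pi / 2 / Complex.cos (Real.pi * s.re / 2)‖)
    refine h2.congr fun x => ?_
    simp only [hF, norm_mul]
    rw [integral_const_mul, integral_norm_mellin_integrand (root_pos x) h0 h1', Complex.norm_real,
      Real.norm_of_nonneg (mul_nonneg (by positivity) (weight_pos hp x).le), neg_sub]
    ring
  have hterm : ∀ y ∈ Ioi (0 : ℝ), HasSum (fun x => F x y)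
      ((y : ℂ) ^ (s - 1) • ((reducedKernel p y : ℝ) : ℂ)) := by
    intro y hy
    refine ((Complex.hasSum_ofReal.2 (hasSum_reducedKernel hp hy)).mul_left _).congr_fun fun x => ?_
    simp only [hF, smul_eq_mul]
    push_cast
    ring
  have h := hasSum_integral_of_summable_integral_norm hint hsum
  have hval : ∫ y in Ioi (0 : ℝ), ∑' x, F x y = mellin (fun y => (reducedKernel p y : ℂ)) s :=
    setIntegral_congr_fun measurableSet_Ioi fun y hy => (hterm y hy).tsum_eq
  rw [hval] at h
  have hc := cos_pi_mul_div_two_ne_zero h0 h1'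
  refine (h.mul_left (Complex.cos (Real.pi * s / 2))).congr_fun fun x => ?_
  have hv := (hasMellin_div_sq_add_sq (root_pos x) h0 h1').2
  rw [mellin] at hv
  have hpc : (Real.pi : ℂ) ≠ 0 := by exact_mod_cast hpi.ne'
  simp only [hF]
  rw [integral_const_mul, hv, zetaTerm, one_div, ← Complex.cpow_neg, neg_sub]
  generalize Complex.cos (Real.pi * s / 2) = c at *
  push_cast
  field_simp

/-! ### Size of the kernels -/

/-- With E = e^{-2πy}, the inequality e^{2πy} ≥ 1 + 2πy gives yE ≤ 1 - E. The bound shows both the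
1/y singularity at 0 and the exponential decay. -/
lemma abs_planaKernel_le_mul_exp {p : ℝ} (hp : 0 < p) {y : ℝ} (hy : 0 < y) :
    |planaKernel p y| ≤ (1 + 1 / y) * Real.exp (-(2 * Real.pi * y)) := by
  refine (abs_planaKernel_le hp hy).trans ?_
  have h1 := exp_neg_two_pi_lt_one hy
  have hE := Real.exp_pos (-(2 * Real.pi * y))
  have h2 : y * Real.exp (-(2 * Real.pi * y)) ≤ 1 - Real.exp (-(2 * Real.pi * y)) := by
    have h3 := Real.add_one_le_exp (2 * Real.pi * y)
    have h4 : Real.exp (2 * Real.pi * y) * Real.exp (-(2 * Real.pi * y)) = 1 := by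
      rw [← Real.exp_add, add_neg_cancel, Real.exp_zero]
    have h5 : y ≤ 2 * Real.pi * y := by nlinarith [Real.pi_gt_three]
    nlinarith
  have h3 : 1 ≤ (1 + 1 / y) * (1 - Real.exp (-(2 * Real.pi * y))) := by
    rw [one_add_div hy.ne', div_mul_eq_mul_div, le_div_iff₀ hy]
    linarith
  rw [div_le_iff₀ (by linarith)]
  nlinarith

lemma abs_planaKernel_le_two_mul_exp {p : ℝ} (hp : 0 < p) {y : ℝ} (hy : 1 ≤ y) :
    |planaKernel p y| ≤ 2 * Real.exp (-(2 * Real.pi * y)) := by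
  refine (abs_planaKernel_le_mul_exp hp (by linarith)).trans ?_
  refine mul_le_mul_of_nonneg_right ?_ (Real.exp_pos _).le
  have : 1 / y ≤ 1 := by rw [div_le_one (by linarith)]; exact hy
  linarith

lemma reducedKernel_nonneg {p : ℝ} (hp : 0 < p) {y : ℝ} (hy : 0 < y) : 0 ≤ reducedKernel p y :=
  (hasSum_reducedKernel hp hy).nonneg fun x : roots p =>
    mul_nonneg (by have := Real.pi_pos; positivity)
      (mul_nonneg (weight_pos hp x).le (div_nonneg hy.le (by positivity)))

/-- A constant `C` with `reducedKernel p y ≤ C * y`. -/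
def reducedBound (p : ℝ) : ℝ := 2 / Real.pi * ∑' x : roots p, 1 / (x : ℝ) ^ 2

/-- From y/(λ² + y²) ≤ y/λ² in the partial fractions. The cancellation at the origin thus needs no
Taylor expansion of the kernel. -/
lemma reducedKernel_le {p : ℝ} (hp : 0 < p) {y : ℝ} (hy : 0 < y) :
    reducedKernel p y ≤ reducedBound p * y := by
  have h := ((summable_root_inv_sq hp).hasSum.mul_left (2 / Real.pi)).mul_right y
  refine hasSum_le (fun x => ?_) (hasSum_reducedKernel hp hy) h
  have hx := root_pos x
  rw [mul_assoc]
  refine mul_le_mul_of_nonneg_left ?_ (by have := Real.pi_pos; positivity)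
  rw [one_div_mul_eq_div]
  refine (mul_le_of_le_one_left (by positivity) (weight_le_one hp x)).trans ?_
  exact div_le_div_of_nonneg_left hy.le (by positivity) (by nlinarith)

lemma abs_reducedKernel_le {p : ℝ} (hp : 0 < p) {y : ℝ} (hy : 0 < y) :
    |reducedKernel p y| ≤ reducedBound p * y := by
  rw [abs_of_nonneg (reducedKernel_nonneg hp hy)]
  exact reducedKernel_le hp hy

lemma measurable_reducedKernel (p : ℝ) : Measurable (reducedKernel p) := by
  have := measurable_planaKernel p
  unfold reducedKernel
  fun_prop

/-! ### Mellin transforms of the kernels -/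

/-- The reduced kernel cut off at `1`. -/
def lowKernel (p : ℝ) : ℝ → ℂ := (Ioc 0 1).indicator fun y => (reducedKernel p y : ℂ)

/-- Twice the kernel, cut off below `1`. -/
def highKernel (p : ℝ) : ℝ → ℂ := (Ioi 1).indicator fun y => ((2 * planaKernel p y : ℝ) : ℂ)

lemma integrable_lowKernel {p : ℝ} (hp : 0 < p) : Integrable (lowKernel p) := by
  rw [lowKernel, integrable_indicator_iff measurableSet_Ioc]
  refine Integrable.mono' (g := fun _ => reducedBound p) (integrableOn_const (by simp)) ?_ ?_
  · exact (Complex.measurable_ofReal.comp (measurable_reducedKernel p)).aestronglyMeasurable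
  · filter_upwards [ae_restrict_mem measurableSet_Ioc] with y hy
    rw [Complex.norm_real]
    have h1 := abs_reducedKernel_le hp hy.1
    have h2 := (reducedKernel_nonneg hp one_pos).trans (reducedKernel_le hp one_pos)
    exact h1.trans (mul_le_of_le_one_right (by linarith) hy.2)

lemma integrable_highKernel {p : ℝ} (hp : 0 < p) : Integrable (highKernel p) := by
  rw [highKernel, integrable_indicator_iff measurableSet_Ioi]
  refine Integrable.mono' (g := fun y => 4 * Real.exp (-(2 * Real.pi) * y))
    ((exp_neg_integrableOn_Ioi 1 Real.two_pi_pos).const_mul 4) ?_ ?_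
  · have := measurable_planaKernel p
    exact Measurable.aestronglyMeasurable (by fun_prop)
  · filter_upwards [ae_restrict_mem measurableSet_Ioi] with y hy
    rw [Complex.norm_real, norm_mul, Real.norm_ofNat, neg_mul]
    have := abs_planaKernel_le_two_mul_exp hp (le_of_lt hy)
    rw [← Real.norm_eq_abs] at this
    linarith

lemma lowKernel_isBigO_atTop (p a : ℝ) : lowKernel p =O[atTop] fun y => y ^ a := by
  refine Asymptotics.IsBigO.of_bound 1 ?_
  filter_upwards [eventually_gt_atTop 1] with y hy
  rw [lowKernel, indicator_of_notMem (fun h => absurd h.2 (not_le.2 hy)), norm_zero]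
  positivity

lemma lowKernel_isBigO_zero {p : ℝ} (hp : 0 < p) :
    lowKernel p =O[𝓝[>] 0] fun y => y ^ (-(-1 : ℝ)) := by
  refine Asymptotics.IsBigO.of_bound (reducedBound p) ?_
  filter_upwards [Ioc_mem_nhdsGT (zero_lt_one' ℝ)] with y hy
  rw [lowKernel, indicator_of_mem hy, Complex.norm_real, neg_neg, Real.rpow_one,
    Real.norm_of_nonneg hy.1.le]
  exact abs_reducedKernel_le hp hy.1

lemma highKernel_isBigO_atTop {p : ℝ} (hp : 0 < p) :
    highKernel p =O[atTop] fun y => Real.exp (-(2 * Real.pi) * y) := by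
  refine Asymptotics.IsBigO.of_bound 4 ?_
  filter_upwards [eventually_gt_atTop 1] with y hy
  rw [highKernel, indicator_of_mem (mem_Ioi.2 hy), Complex.norm_real, Real.norm_of_nonneg (Real.exp_pos _).le,
    neg_mul, norm_mul, Real.norm_ofNat]
  have := abs_planaKernel_le_two_mul_exp hp hy.le
  rw [← Real.norm_eq_abs] at this
  linarith

lemma highKernel_isBigO_zero (p a : ℝ) : highKernel p =O[𝓝[>] 0] fun y => y ^ a := by
  refine Asymptotics.IsBigO.of_bound 1 ?_
  filter_upwards [Ioc_mem_nhdsGT (zero_lt_one' ℝ)] with y hy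
  rw [highKernel, indicator_of_notMem (notMem_Ioi.2 hy.2), norm_zero]
  positivity

lemma mellinConvergent_lowKernel {p : ℝ} (hp : 0 < p) {s : ℂ} (hs : -1 < s.re) :
    MellinConvergent (lowKernel p) s :=
  mellinConvergent_of_isBigO_rpow ((integrable_lowKernel hp).locallyIntegrable.locallyIntegrableOn _)
    (lowKernel_isBigO_atTop p _) (lt_add_one _) (lowKernel_isBigO_zero hp) hs

lemma differentiableAt_mellin_lowKernel {p : ℝ} (hp : 0 < p) {s : ℂ} (hs : -1 < s.re) :
    DifferentiableAt ℂ (mellin (lowKernel p)) s :=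
  mellin_differentiableAt_of_isBigO_rpow
    ((integrable_lowKernel hp).locallyIntegrable.locallyIntegrableOn _)
    (lowKernel_isBigO_atTop p _) (lt_add_one _) (lowKernel_isBigO_zero hp) hs

lemma mellinConvergent_highKernel {p : ℝ} (hp : 0 < p) (s : ℂ) :
    MellinConvergent (highKernel p) s :=
  mellinConvergent_of_isBigO_rpow_exp Real.two_pi_pos
    ((integrable_highKernel hp).locallyIntegrable.locallyIntegrableOn _)
    (highKernel_isBigO_atTop hp) (highKernel_isBigO_zero p _) (sub_one_lt _)

lemma differentiableAt_mellin_highKernel {p : ℝ} (hp : 0 < p) (s : ℂ) :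
    DifferentiableAt ℂ (mellin (highKernel p)) s :=
  mellin_differentiableAt_of_isBigO_rpow_exp Real.two_pi_pos
    ((integrable_highKernel hp).locallyIntegrable.locallyIntegrableOn _)
    (highKernel_isBigO_atTop hp) (highKernel_isBigO_zero p _) (sub_one_lt _)

/-- On (0, 1] the same power has transform 1/(s + a), in the complementary half plane. The opposite
sign makes adding a power beyond 1 equivalent to removing it below 1, which is the continuation
mechanism. -/
lemma hasMellin_cpow_Ioi_one {a s : ℂ} (hs : s.re + a.re < 0) :
    HasMellin ((Ioi 1).indicator fun t : ℝ => (t : ℂ) ^ a) s (-(1 / (s + a))) := by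
  have h1 : (s + a - 1).re < -1 := by simp; linarith
  have h2 : ∀ t ∈ Ioi (0 : ℝ), (t : ℂ) ^ (s - 1) • (Ioi 1).indicator (fun t : ℝ => (t : ℂ) ^ a) t =
      (Ioi 1).indicator (fun t : ℝ => (t : ℂ) ^ (s + a - 1)) t := by
    intro t ht
    by_cases h : t ∈ Ioi (1 : ℝ)
    · rw [indicator_of_mem h, indicator_of_mem h, smul_eq_mul,
        ← Complex.cpow_add _ _ (by exact_mod_cast (ne_of_gt ht : t ≠ 0))]
      ring_nf
    · rw [indicator_of_notMem h, indicator_of_notMem h, smul_zero]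
  have h3 : Ioi (1 : ℝ) ∩ Ioi 0 = Ioi 1 := inter_eq_left.2 (Ioi_subset_Ioi zero_le_one)
  constructor
  · refine IntegrableOn.congr_fun ?_ (fun t ht => (h2 t ht).symm) measurableSet_Ioi
    exact ((integrable_indicator_iff measurableSet_Ioi).2
      (integrableOn_Ioi_cpow_of_lt h1 one_pos)).integrableOn
  · rw [mellin, setIntegral_congr_fun measurableSet_Ioi h2, integral_indicator measurableSet_Ioi,
      Measure.restrict_restrict measurableSet_Ioi, h3, integral_Ioi_cpow_of_lt h1 one_pos]
    simp [neg_div]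

lemma mellin_reducedKernel {p : ℝ} (hp : 0 < p) {s : ℂ} (h0 : -1 < s.re) (h1 : s.re < 0) :
    mellin (fun y => (reducedKernel p y : ℂ)) s =
      mellin (lowKernel p) s + mellin (highKernel p) s - 1 / s +
        (weight p 0 / Real.pi : ℝ) * (1 / (s - 1)) := by
  obtain ⟨c1, v1⟩ := hasMellin_cpow_Ioi_one (a := 0) (s := s) (by simpa using h1)
  obtain ⟨c2, v2⟩ := hasMellin_cpow_Ioi_one (a := -1) (s := s) (by simp; linarith)
  obtain ⟨c3, v3⟩ := hasMellin_const_smul c2 ((weight p 0 / Real.pi : ℝ) : ℂ)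
  obtain ⟨c4, v4⟩ := hasMellin_add (mellinConvergent_lowKernel hp h0)
    (mellinConvergent_highKernel hp s)
  obtain ⟨c5, v5⟩ := hasMellin_add c4 c1
  obtain ⟨-, v6⟩ := hasMellin_sub c5 c3
  rw [v5, v4, v1, v3, v2] at v6
  refine Eq.trans (setIntegral_congr_fun measurableSet_Ioi fun y hy => ?_) (v6.trans ?_)
  · have hy' : (0 : ℝ) < y := hy
    dsimp only
    congr 1
    rcases le_or_gt y 1 with h | h
    · have hm : y ∈ Ioc (0 : ℝ) 1 := ⟨hy', h⟩
      rw [lowKernel, highKernel, indicator_of_mem hm, indicator_of_notMem (notMem_Ioi.2 h),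
        indicator_of_notMem (notMem_Ioi.2 h), indicator_of_notMem (notMem_Ioi.2 h)]
      simp
    · rw [lowKernel, highKernel, indicator_of_notMem (fun h' => absurd h'.2 (not_le.2 h)),
        indicator_of_mem (mem_Ioi.2 h), indicator_of_mem (mem_Ioi.2 h),
        indicator_of_mem (mem_Ioi.2 h), reducedKernel, Complex.cpow_zero, Complex.cpow_neg_one,
        smul_eq_mul]
      push_cast
      rw [div_mul_eq_div_div]
      ring
  · rw [smul_eq_mul]
    ring

/-- On (0, 1], 2K is the reduced kernel minus 1 plus w(0)/(πy). The outcome is the same expression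
as for the reduced kernel in the strip -1 < Re s < 0. -/
lemma mellin_planaKernel {p : ℝ} (hp : 0 < p) {s : ℂ} (hs : 1 < s.re) :
    2 * mellin (fun y => (planaKernel p y : ℂ)) s =
      mellin (lowKernel p) s + mellin (highKernel p) s - 1 / s +
        (weight p 0 / Real.pi : ℝ) * (1 / (s - 1)) := by
  obtain ⟨c1, v1⟩ := hasMellin_cpow_Ioc 0 (s := s) (by simp; linarith)
  obtain ⟨c2, v2⟩ := hasMellin_cpow_Ioc (-1) (s := s) (by simp; linarith)
  obtain ⟨c3, v3⟩ := hasMellin_const_smul c2 ((weight p 0 / Real.pi : ℝ) : ℂ)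
  obtain ⟨c4, v4⟩ := hasMellin_add (mellinConvergent_lowKernel hp (by linarith))
    (mellinConvergent_highKernel hp s)
  obtain ⟨c5, v5⟩ := hasMellin_sub c4 c1
  obtain ⟨-, v6⟩ := hasMellin_add c5 c3
  rw [v5, v4, v1, v3, v2] at v6
  rw [← smul_eq_mul (2 : ℂ), ← mellin_const_smul]
  refine Eq.trans (setIntegral_congr_fun measurableSet_Ioi fun y hy => ?_) (v6.trans ?_)
  · have hy' : (0 : ℝ) < y := hy
    dsimp only
    congr 1
    rcases le_or_gt y 1 with h | h
    · have hm : y ∈ Ioc (0 : ℝ) 1 := ⟨hy', h⟩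
      rw [lowKernel, highKernel, indicator_of_mem hm, indicator_of_notMem (notMem_Ioi.2 h),
        indicator_of_mem hm, indicator_of_mem hm, reducedKernel,
        Complex.cpow_zero, Complex.cpow_neg_one, smul_eq_mul, smul_eq_mul]
      push_cast
      rw [div_mul_eq_div_div]
      ring
    · rw [lowKernel, highKernel, indicator_of_notMem (fun h' => absurd h'.2 (not_le.2 h)),
        indicator_of_mem (mem_Ioi.2 h), indicator_of_notMem (fun h' => absurd h'.2 (not_le.2 h)),
        indicator_of_notMem (fun h' => absurd h'.2 (not_le.2 h))]
      simp
  · rw [smul_eq_mul]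
    ring

/-! ### The continuation of the first zeta function -/

lemma differentiableOn_tsum_zetaTerm {p : ℝ} (hp : 0 < p) :
    DifferentiableOn ℂ (fun s => ∑' x, zetaTerm p s x) {s | 1 < s.re} := by
  intro s₀ hs₀
  have hs₀' : 1 < s₀.re := hs₀
  set a : ℝ := (1 + s₀.re) / 2
  set b : ℝ := s₀.re + 1
  have ha : 1 < a := by simp only [a]; linarith
  set V : Set ℂ := {s | a < s.re} ∩ {s | s.re < b}
  have hV : IsOpen V := (isOpen_lt continuous_const Complex.continuous_re).inter
    (isOpen_lt Complex.continuous_re continuous_const)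
  have hsV : s₀ ∈ V := ⟨by show a < s₀.re; simp only [a]; linarith,
    by show s₀.re < b; simp only [b]; linarith⟩
  -- Both exponents are needed on a < Re s < b: the first dominates at roots above 1, the second at
  -- a root below 1.
  have hsum : Summable fun x : roots p => (x : ℝ) ^ (-a) + (x : ℝ) ^ (-b) :=
    (summable_root_rpow hp ha).add (summable_root_rpow hp (by simp only [b]; linarith))
  have hd := Complex.differentiableOn_tsum_of_summable_norm (F := fun x s => zetaTerm p s x) hsum
    (fun x => by
      have hx : ((x : ℝ) : ℂ) ≠ 0 := by exact_mod_cast (root_pos x).ne'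
      refine DifferentiableOn.const_mul (DifferentiableOn.div (by fun_prop) ?_ ?_) _
      · exact (differentiable_id.const_cpow (Or.inl hx)).differentiableOn
      · intro s _
        simp [Complex.cpow_eq_zero_iff, hx]) hV
    (fun x s hs => by
      have hs1 : a < s.re := hs.1
      have hs2 : s.re < b := hs.2
      rw [norm_zetaTerm hp]
      refine (mul_le_of_le_one_left (Real.rpow_nonneg (root_pos x).le _)
        (weight_le_one hp x)).trans ?_
      have h1 := Real.rpow_nonneg (root_pos x).le (-a)
      have h2 := Real.rpow_nonneg (root_pos x).le (-b)
      rcases le_total 1 (x : ℝ) with hx | hx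
      · have := Real.rpow_le_rpow_of_exponent_le hx (by linarith : -s.re ≤ -a)
        linarith
      · have := Real.rpow_le_rpow_of_exponent_ge (root_pos x) hx (by linarith : -b ≤ -s.re)
        linarith)
  exact ((hd s₀ hsV).differentiableAt (hV.mem_nhds hsV)).differentiableWithinAt

/-- The continuation of `s ↦ zeta p (1 - s)` to the half plane `-1 < Re s`. -/
def reflectedZeta (p : ℝ) (s : ℂ) : ℂ :=
  Complex.cos (Real.pi * s / 2) * (mellin (lowKernel p) s + mellin (highKernel p) s - 1 / s) +
    (weight p 0 / Real.pi : ℝ) * dslope (fun s : ℂ => Complex.cos (Real.pi * s / 2)) 1 s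

/-- The pole of 1/(s - 1) is cancelled by the zero of cos(πs/2) at 1, hence the `dslope`. The
excluded point s = 0 corresponds to the point 1 excluded for zeta. -/
lemma differentiableAt_reflectedZeta {p : ℝ} (hp : 0 < p) {s : ℂ} (hs : -1 < s.re) (h0 : s ≠ 0) :
    DifferentiableAt ℂ (reflectedZeta p) s := by
  have h1 : Differentiable ℂ (fun s : ℂ => Complex.cos (Real.pi * s / 2)) := by fun_prop
  have h2 : DifferentiableAt ℂ (dslope (fun s : ℂ => Complex.cos (Real.pi * s / 2)) 1) s :=
    ((Complex.differentiableOn_dslope (s := univ) univ_mem).2 h1.differentiableOn).differentiableAt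
      univ_mem
  have h3 := differentiableAt_mellin_lowKernel hp hs
  have h4 := differentiableAt_mellin_highKernel hp s
  have h5 : DifferentiableAt ℂ (fun s : ℂ => 1 / s) s := by
    fun_prop (disch := assumption)
  exact ((h1 s).mul ((h3.add h4).sub h5)).add (h2.const_mul _)

lemma reflectedZeta_of_ne_one (p : ℝ) {s : ℂ} (hs : s ≠ 1) :
    reflectedZeta p s = Complex.cos (Real.pi * s / 2) *
      (mellin (lowKernel p) s + mellin (highKernel p) s - 1 / s +
        (weight p 0 / Real.pi : ℝ) * (1 / (s - 1))) := by
  rw [reflectedZeta, dslope_of_ne _ hs, slope_def_field, mul_one, Complex.cos_pi_div_two]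
  ring

lemma reflectedZeta_eq_tsum {p : ℝ} (hp : 0 < p) {s : ℂ} (h0 : -1 < s.re) (h1 : s.re < 0) :
    reflectedZeta p s = ∑' x, zetaTerm p (1 - s) x := by
  have hs : s ≠ 1 := by
    rintro rfl
    simp at h1
    linarith
  rw [(hasSum_zetaTerm_mellin hp h0 h1).tsum_eq, reflectedZeta_of_ne_one p hs,
    mellin_reducedKernel hp h0 h1]

lemma reflectedZeta_eq_mellin {p : ℝ} (hp : 0 < p) {s : ℂ} (hs : 1 < s.re) :
    reflectedZeta p s = 2 * Complex.cos (Real.pi * s / 2) *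
      mellin (fun y => (planaKernel p y : ℂ)) s := by
  have h1 : s ≠ 1 := by
    rintro rfl
    simp at hs
  rw [reflectedZeta_of_ne_one p h1, ← mellin_planaKernel hp hs]
  ring

/-- An explicit form of the continuation of the first zeta function. -/
def explicitZeta (p : ℝ) (s : ℂ) : ℂ :=
  if 1 < s.re then ∑' x, zetaTerm p s x else reflectedZeta p (1 - s)

/-- On the overlap 1 < Re s < 2 the point 1 - s lies in the strip where the Mellin formula holds, so
the two branches agree and the gluing is holomorphic across Re s = 1. -/
lemma explicitZeta_of_re_lt_two {p : ℝ} (hp : 0 < p) {s : ℂ} (hs : s.re < 2) :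
    explicitZeta p s = reflectedZeta p (1 - s) := by
  rw [explicitZeta]
  split_ifs with h
  · rw [reflectedZeta_eq_tsum hp (by simp; linarith) (by simpa using h), sub_sub_cancel]
  · rfl

lemma isZetaContinuation_explicitZeta {p : ℝ} (hp : 0 < p) :
    IsZetaContinuation p (explicitZeta p) := by
  constructor
  · intro s hs
    refine DifferentiableAt.differentiableWithinAt ?_
    rcases lt_or_ge 1 s.re with h | h
    · have hU : IsOpen {s : ℂ | 1 < s.re} := isOpen_lt continuous_const Complex.continuous_re
      refine ((differentiableOn_tsum_zetaTerm hp s h).differentiableAt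
        (hU.mem_nhds h)).congr_of_eventuallyEq ?_
      filter_upwards [hU.mem_nhds h] with z hz
      exact if_pos hz
    · have hU : IsOpen {s : ℂ | s.re < 2} := isOpen_lt Complex.continuous_re continuous_const
      have hd : DifferentiableAt ℂ (reflectedZeta p) (1 - s) :=
        differentiableAt_reflectedZeta hp (by simp; linarith) (sub_ne_zero.2 (Ne.symm hs))
      have hd' : DifferentiableAt ℂ (fun z => reflectedZeta p (1 - z)) s :=
        hd.comp s ((differentiableAt_const 1).sub differentiableAt_id)
      refine hd'.congr_of_eventuallyEq ?_
      filter_upwards [hU.mem_nhds (by show s.re < 2; linarith)] with z hz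
      exact explicitZeta_of_re_lt_two hp hz
  · intro s hs
    rw [explicitZeta, if_pos hs]
    exact (summable_norm_zetaTerm hp hs).of_norm.hasSum

lemma isZetaContinuation_zeta {p : ℝ} (hp : 0 < p) : IsZetaContinuation p (zeta p) :=
  Classical.epsilon_spec ⟨explicitZeta p, isZetaContinuation_explicitZeta hp⟩

lemma IsZetaContinuation.eq {p : ℝ} {Y Z : ℂ → ℂ} (hY : IsZetaContinuation p Y)
    (hZ : IsZetaContinuation p Z) {s : ℂ} (hs : s ≠ 1) : Y s = Z s := by
  have hconn : IsPreconnected ({1}ᶜ : Set ℂ) :=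
    (isConnected_compl_singleton_of_one_lt_rank (by simp) 1).isPreconnected
  have hU : IsOpen {s : ℂ | 1 < s.re} := isOpen_lt continuous_const Complex.continuous_re
  have h2 : (2 : ℂ) ∈ {s : ℂ | 1 < s.re} := by simp
  refine (hY.differentiableOn.analyticOnNhd isOpen_compl_singleton).eqOn_of_preconnected_of_eventuallyEq
    (hZ.differentiableOn.analyticOnNhd isOpen_compl_singleton) hconn
    (show (2 : ℂ) ∈ ({1}ᶜ : Set ℂ) by simp) ?_ hs
  filter_upwards [hU.mem_nhds h2] with z hz
  exact (hY.hasSum z hz).unique (hZ.hasSum z hz)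

/-- The functional equation relating the two zeta functions. -/
lemma zeta_one_sub {p : ℝ} (hp : 0 < p) {s : ℂ} (hs : 1 < s.re) :
    zeta p (1 - s) = 2 * Complex.cos (Real.pi * s / 2) *
      mellin (fun y => (planaKernel p y : ℂ)) s := by
  have h1 : 1 - s ≠ 1 := by
    intro h
    have := congrArg Complex.re h
    simp at this
    linarith
  rw [(isZetaContinuation_zeta hp).eq (isZetaContinuation_explicitZeta hp) h1,
    explicitZeta_of_re_lt_two hp (by simp; linarith), sub_sub_cancel,
    reflectedZeta_eq_mellin hp hs]

/-! ### Sine integrals of rational functions -/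

open scoped FourierTransform in
lemma fourier_exp_neg_abs (w : ℝ) :
    𝓕 (fun x : ℝ => ((Real.exp (-|x|) : ℝ) : ℂ)) w = ((2 / (1 + (2 * Real.pi * w) ^ 2) : ℝ) : ℂ) := by
  rw [Real.fourier_real_eq_integral_exp_smul]
  set a : ℂ := -1 - 2 * Real.pi * w * Complex.I
  set b : ℂ := 1 - 2 * Real.pi * w * Complex.I
  have ha : a.re < 0 := by simp [a]
  have hb : 0 < b.re := by simp [b]
  have h1 : EqOn (fun v : ℝ => Complex.exp (((-2 * Real.pi * v * w : ℝ) : ℂ) * Complex.I) •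
      ((Real.exp (-|v|) : ℝ) : ℂ)) (fun v : ℝ => Complex.exp (a * v)) (Ioi 0) := by
    intro v hv
    simp only [smul_eq_mul]
    rw [abs_of_pos hv, Complex.ofReal_exp, ← Complex.exp_add]
    congr 1
    simp only [a]
    push_cast
    ring
  have h2 : EqOn (fun v : ℝ => Complex.exp (((-2 * Real.pi * v * w : ℝ) : ℂ) * Complex.I) •
      ((Real.exp (-|v|) : ℝ) : ℂ)) (fun v : ℝ => Complex.exp (b * v)) (Iic 0) := by
    intro v hv
    simp only [smul_eq_mul]
    rw [abs_of_nonpos hv, Complex.ofReal_exp, ← Complex.exp_add]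
    congr 1
    simp only [b]
    push_cast
    ring
  rw [← intervalIntegral.integral_Iic_add_Ioi (b := 0)
    ((integrableOn_exp_mul_complex_Iic hb 0).congr_fun h2.symm measurableSet_Iic)
    ((integrableOn_exp_mul_complex_Ioi ha 0).congr_fun h1.symm measurableSet_Ioi),
    setIntegral_congr_fun measurableSet_Iic h2, setIntegral_congr_fun measurableSet_Ioi h1,
    integral_exp_mul_complex_Iic hb, integral_exp_mul_complex_Ioi ha]
  have ha0 : a ≠ 0 := fun h => by simp [h] at ha
  have hb0 : b ≠ 0 := fun h => by simp [h] at hb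
  have hab : (1 + (2 * Real.pi * w) ^ 2 : ℂ) = -(a * b) := by
    simp only [a, b]
    linear_combination (2 * Real.pi * w : ℂ) ^ 2 * Complex.I_sq
  have hba : b - a = 2 := by simp only [a, b]; ring
  push_cast
  rw [hab, ← hba]
  simp only [mul_zero, Complex.exp_zero]
  field_simp
  ring

lemma integrable_exp_neg_abs : Integrable fun x : ℝ => ((Real.exp (-|x|) : ℝ) : ℂ) := by
  have h : Integrable fun x : ℝ => Real.exp (-|x|) := by
    rw [← integrableOn_univ, ← Iic_union_Ioi (a := 0), integrableOn_union]
    constructor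
    · refine (integrableOn_exp_mul_Iic one_pos 0).congr_fun (fun x hx => ?_) measurableSet_Iic
      simp only [abs_of_nonpos (mem_Iic.1 hx), one_mul, neg_neg]
    · refine (exp_neg_integrableOn_Ioi 0 one_pos).congr_fun (fun x hx => ?_) measurableSet_Ioi
      simp only [abs_of_pos (mem_Ioi.1 hx), neg_mul, one_mul]
  exact h.ofReal

/-- The real part of Fourier inversion for e^{-|x|}. -/
lemma integral_cos_div_one_add_sq (t : ℝ) :
    ∫ y : ℝ, Real.cos (y * t) * (1 + y ^ 2)⁻¹ = Real.pi * Real.exp (-|t|) := by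
  have hpi := Real.pi_pos
  have hint : Integrable fun w : ℝ => ((2 / (1 + (2 * Real.pi * w) ^ 2) : ℝ) : ℂ) := by
    have h : Integrable fun w : ℝ => 2 / (1 + (2 * Real.pi * w) ^ 2) := by
      simp only [div_eq_mul_inv]
      exact (integrable_inv_one_add_sq.comp_mul_left' Real.two_pi_pos.ne').const_mul 2
    exact h.ofReal
  have h := integrable_exp_neg_abs.fourierInv_fourier_eq (v := t)
    (by simpa only [funext fourier_exp_neg_abs] using hint) (by fun_prop)
  rw [funext fourier_exp_neg_abs, Real.fourierInv_eq'] at h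
  have h1 := congrArg Complex.re h
  rw [← RCLike.re_eq_complex_re, ← integral_re] at h1
  · have h2 : ∀ w : ℝ, RCLike.re (Complex.exp (((2 * Real.pi * inner ℝ w t : ℝ) : ℂ) * Complex.I) •
        ((2 / (1 + (2 * Real.pi * w) ^ 2) : ℝ) : ℂ)) =
        2 * (Real.cos ((2 * Real.pi * w) * t) * (1 + (2 * Real.pi * w) ^ 2)⁻¹) := by
      intro w
      rw [smul_eq_mul, mul_comm, RCLike.re_eq_complex_re, Complex.re_ofReal_mul,
        Complex.exp_ofReal_mul_I_re]
      simp
      ring_nf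
    simp only [h2] at h1
    rw [integral_const_mul, Measure.integral_comp_mul_left
      (fun y => Real.cos (y * t) * (1 + y ^ 2)⁻¹)] at h1
    rw [abs_of_pos (by positivity)] at h1
    rw [RCLike.re_eq_complex_re, Complex.ofReal_re, smul_eq_mul] at h1
    generalize (∫ y : ℝ, Real.cos (y * t) * (1 + y ^ 2)⁻¹) = J at h1 ⊢
    rw [← h1]
    field_simp
  · refine Integrable.mono hint ?_ ?_
    · have h2 : Continuous fun v : ℝ =>
          Complex.exp (((2 * Real.pi * inner ℝ v t : ℝ) : ℂ) * Complex.I) := by fun_prop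
      exact h2.aestronglyMeasurable.smul hint.aestronglyMeasurable
    · refine ae_of_all _ fun w => ?_
      rw [norm_smul, Complex.norm_exp_ofReal_mul_I, one_mul]

/-- The cosine formula is integrated over the parameter from 0 to t; the integrand is even in y,
which gives the factor 1/2. -/
lemma integral_sin_div_mul_one_add_sq {t : ℝ} (ht : 0 ≤ t) :
    ∫ y in Ioi (0 : ℝ), Real.sin (y * t) / y * (1 + y ^ 2)⁻¹ =
      Real.pi / 2 * (1 - Real.exp (-t)) := by
  have : IsFiniteMeasure (volume.restrict (uIoc 0 t)) := ⟨by simp [uIoc]⟩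
  have hint : Integrable (Function.uncurry fun (x y : ℝ) => Real.cos (y * x) * (1 + y ^ 2)⁻¹)
      ((volume.restrict (uIoc 0 t)).prod volume) := by
    have h1 : Integrable (Function.uncurry fun (_ y : ℝ) => (1 : ℝ) * (1 + y ^ 2)⁻¹)
        ((volume.restrict (uIoc 0 t)).prod volume) :=
      Integrable.mul_prod (f := fun _ : ℝ => (1 : ℝ)) (integrable_const _) integrable_inv_one_add_sq
    refine h1.mono (Measurable.aestronglyMeasurable ?_) (ae_of_all _ fun z => ?_)
    · simp only [Function.uncurry_def]
      fun_prop
    · simp only [Function.uncurry_def, norm_mul, norm_one]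
      exact mul_le_mul_of_nonneg_right (Real.abs_cos_le_one _) (norm_nonneg _)
  have h := intervalIntegral_integral_swap hint
  simp only [integral_cos_div_one_add_sq, intervalIntegral.integral_mul_const] at h
  have h1 : ∫ x in (0 : ℝ)..t, Real.pi * Real.exp (-|x|) = Real.pi * (1 - Real.exp (-t)) := by
    rw [intervalIntegral.integral_const_mul]
    congr 1
    have h2 : ∫ x in (0 : ℝ)..t, Real.exp (-|x|) = ∫ x in (0 : ℝ)..t, Real.exp (-x) := by
      refine intervalIntegral.integral_congr fun x hx => ?_
      rw [uIcc_of_le ht] at hx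
      simp only [abs_of_nonneg hx.1]
    rw [h2, intervalIntegral.integral_comp_neg Real.exp, integral_exp]
    simp
  have h3 : ∀ y : ℝ, y ≠ 0 → ∫ x in (0 : ℝ)..t, Real.cos (y * x) = Real.sin (y * t) / y := by
    intro y hy
    rw [intervalIntegral.integral_comp_mul_left _ hy, integral_cos]
    simp [div_eq_inv_mul]
  have h4 : ∫ y : ℝ, (∫ x in (0 : ℝ)..t, Real.cos (y * x)) * (1 + y ^ 2)⁻¹ =
      ∫ y : ℝ, (fun y => Real.sin (y * t) / y * (1 + y ^ 2)⁻¹) |y| := by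
    refine integral_congr_ae ?_
    filter_upwards [compl_mem_ae_iff.2 (measure_singleton (0 : ℝ))] with y hy
    have hy' : y ≠ 0 := hy
    simp only [h3 y hy', sq_abs]
    rcases lt_or_gt_of_ne hy' with hn | hn
    · rw [abs_of_neg hn, neg_mul, Real.sin_neg, neg_div_neg_eq]
    · rw [abs_of_pos hn]
  rw [h1, h4, integral_comp_abs (f := fun y => Real.sin (y * t) / y * (1 + y ^ 2)⁻¹)] at h
  linarith

lemma integral_sin_div_mul_sq_add_sq {l t : ℝ} (hl : 0 < l) (ht : 0 ≤ t) :
    ∫ y in Ioi (0 : ℝ), Real.sin (y * t) / y / (l ^ 2 + y ^ 2) =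
      Real.pi / 2 * (1 - Real.exp (-l * t)) / l ^ 2 := by
  have h1 := integral_comp_mul_left_Ioi
    (fun y => Real.sin (y * t) / y / (l ^ 2 + y ^ 2)) 0 hl
  have h2 := integral_sin_div_mul_one_add_sq (mul_nonneg hl.le ht)
  rw [mul_zero, smul_eq_mul] at h1
  have h3 : ∀ v : ℝ, Real.sin (l * v * t) / (l * v) / (l ^ 2 + (l * v) ^ 2) =
      (l ^ 3)⁻¹ * (Real.sin (v * (l * t)) / v * (1 + v ^ 2)⁻¹) := by
    intro v
    have h4 : (1 + v ^ 2 : ℝ) ≠ 0 := by positivity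
    have h5 : l ^ 2 + (l * v) ^ 2 = l ^ 2 * (1 + v ^ 2) := by ring
    rw [h5, show l * v * t = v * (l * t) by ring]
    rcases eq_or_ne v 0 with rfl | hv
    · simp
    · field_simp
  simp only [h3] at h1
  rw [integral_const_mul, h2] at h1
  rw [neg_mul]
  field_simp at h1 ⊢
  linarith

/-! ### A second antiderivative of the exponential sum -/

/-- The negative of a second antiderivative of `sigma p` on the positive real axis. -/
def sigmaPrimitive (p t : ℝ) : ℝ :=
  ∑' x : roots p, weight p x / (x : ℝ) ^ 2 * (1 - Real.exp (-x * t))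

/-- |sin u| ≤ √u interpolates between the bounds 1 and u. The right side is shaped to match the
Mellin integrand at s = -1/2. -/
lemma abs_sin_mul_div_le {t y : ℝ} (ht : 0 ≤ t) (hy : 0 < y) :
    |Real.sin (y * t) / y| ≤ Real.sqrt t * (y ^ ((-1 / 2 : ℝ) - 1) * y) := by
  have hu : 0 ≤ y * t := mul_nonneg hy.le ht
  have h1 : |Real.sin (y * t)| ≤ Real.sqrt (y * t) := by
    apply Real.abs_le_sqrt
    rw [← sq_abs]
    have h2 := Real.abs_sin_le_one (y * t)
    have h3 : |Real.sin (y * t)| ≤ y * t := by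
      have := Real.abs_sin_le_abs (x := y * t)
      rwa [abs_of_nonneg hu] at this
    nlinarith [abs_nonneg (Real.sin (y * t))]
  have h2 : y ^ ((-1 / 2 : ℝ) - 1) * y = Real.sqrt y / y := by
    rw [Real.sqrt_eq_rpow, ← Real.rpow_add_one hy.ne', ← Real.rpow_sub_one hy.ne']
    norm_num
  rw [abs_div, abs_of_pos hy, h2, ← mul_div_assoc, ← Real.sqrt_mul ht, mul_comm t y]
  exact div_le_div_of_nonneg_right h1 hy.le

/-- The sine transform of the partial fractions. Two integrations in t supply the factor 1/y² that
makes everything absolutely convergent. -/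
lemma sigmaPrimitive_eq_integral {p : ℝ} (hp : 0 < p) {t : ℝ} (ht : 0 ≤ t) :
    sigmaPrimitive p t = ∫ y in Ioi (0 : ℝ), Real.sin (y * t) / y ^ 2 * reducedKernel p y := by
  have := countable_roots hp
  have hpi := Real.pi_pos
  set F : roots p → ℝ → ℝ := fun x y =>
    2 / Real.pi * weight p x * (Real.sin (y * t) / y / ((x : ℝ) ^ 2 + y ^ 2)) with hF
  -- A point of the strip -1 < Re s < 0: the norms are controlled by Σ λ^{-3/2}.
  set s : ℂ := ((-1 / 2 : ℝ) : ℂ) with hs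
  have hsre : s.re = -1 / 2 := Complex.ofReal_re _
  set M : roots p → ℝ → ℝ := fun x y =>
    ‖(y : ℂ) ^ (s - 1) • ((y / ((x : ℝ) ^ 2 + y ^ 2) : ℝ) : ℂ)‖ with hM
  have hMint : ∀ x, IntegrableOn (M x) (Ioi 0) := fun x =>
    (hasMellin_div_sq_add_sq (root_pos x) (by rw [hsre]; norm_num) (by rw [hsre]; norm_num)).1.norm
  have hbound : ∀ x, ∀ y ∈ Ioi (0 : ℝ), ‖F x y‖ ≤
      2 / Real.pi * Real.sqrt t * (weight p x * M x y) := by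
    intro x y hy
    have hy' : (0 : ℝ) < y := hy
    have hx := root_pos x
    have h1 := abs_sin_mul_div_le ht hy'
    have hw := weight_pos hp x
    have hM' : M x y = y ^ ((-1 / 2 : ℝ) - 1) * (y / ((x : ℝ) ^ 2 + y ^ 2)) := by
      simp only [hM]
      rw [norm_mellin_integrand (f := fun y => y / ((x : ℝ) ^ 2 + y ^ 2)) s hy' (by positivity),
        hsre]
    simp only [hF]
    rw [hM', norm_mul, Real.norm_of_nonneg (by positivity), norm_div,
      Real.norm_of_nonneg (by positivity : 0 ≤ (x : ℝ) ^ 2 + y ^ 2), Real.norm_eq_abs]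
    calc 2 / Real.pi * weight p x * (|Real.sin (y * t) / y| / ((x : ℝ) ^ 2 + y ^ 2))
        ≤ 2 / Real.pi * weight p x * (Real.sqrt t * (y ^ ((-1 / 2 : ℝ) - 1) * y) /
            ((x : ℝ) ^ 2 + y ^ 2)) := by gcongr
      _ = _ := by ring
  have hint : ∀ x, IntegrableOn (F x) (Ioi 0) := by
    intro x
    refine Integrable.mono' (((hMint x).const_mul (weight p x)).const_mul
      (2 / Real.pi * Real.sqrt t)) ?_ ?_
    · apply Measurable.aestronglyMeasurable
      simp only [hF]
      fun_prop
    · filter_upwards [ae_restrict_mem measurableSet_Ioi] with y hy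
      exact hbound x y hy
  have hsum : Summable fun x => ∫ y in Ioi (0 : ℝ), ‖F x y‖ := by
    have h2 := (summable_weight_mul hp (fun x : roots p => Real.rpow_nonneg (root_pos x).le _)
      (summable_root_rpow hp (by norm_num : (1 : ℝ) < 3 / 2))).mul_left
        (2 / Real.pi * Real.sqrt t * ‖Real.pi / 2 / Complex.cos (Real.pi * s.re / 2)‖)
    refine Summable.of_nonneg_of_le (fun x => integral_nonneg fun y => norm_nonneg _)
      (fun x => ?_) h2
    refine (setIntegral_mono_on (hint x).norm (((hMint x).const_mul (weight p x)).const_mul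
      (2 / Real.pi * Real.sqrt t)) measurableSet_Ioi (hbound x)).trans_eq ?_
    rw [integral_const_mul, integral_const_mul, integral_norm_mellin_integrand (root_pos x)
      (by rw [hsre]; norm_num) (by rw [hsre]; norm_num), hsre]
    norm_num
    ring
  have h := hasSum_integral_of_summable_integral_norm hint hsum
  have hval : ∫ y in Ioi (0 : ℝ), ∑' x, F x y =
      ∫ y in Ioi (0 : ℝ), Real.sin (y * t) / y ^ 2 * reducedKernel p y := by
    refine setIntegral_congr_fun measurableSet_Ioi fun y hy => ?_
    have hy' : y ≠ 0 := ne_of_gt hy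
    rw [← ((hasSum_reducedKernel hp hy).mul_left (Real.sin (y * t) / y ^ 2)).tsum_eq]
    refine tsum_congr fun x => ?_
    simp only [hF]
    field_simp
  rw [hval] at h
  rw [← h.tsum_eq, sigmaPrimitive]
  refine tsum_congr fun x => ?_
  simp only [hF]
  rw [integral_const_mul, integral_sin_div_mul_sq_add_sq (root_pos x) ht]
  have := (root_pos x).ne'
  field_simp

lemma hasDerivAt_exp_neg_mul (a t : ℝ) :
    HasDerivAt (fun t => Real.exp (-a * t)) (-a * Real.exp (-a * t)) t := by
  have := ((hasDerivAt_id t).const_mul (-a)).exp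
  simpa [mul_comm] using this

lemma summable_inv_root_mul_exp {p : ℝ} (hp : 0 < p) {t : ℝ} (ht : 0 < t) :
    Summable fun x : roots p => weight p x / x * Real.exp (-x * t) := by
  refine Summable.of_nonneg_of_le (fun x => ?_) (fun x => ?_)
    ((summable_exp_neg_root hp ht).mul_left 2)
  · exact mul_nonneg (div_nonneg (weight_pos hp x).le (root_pos x).le) (Real.exp_pos _).le
  · refine mul_le_mul_of_nonneg_right ?_ (Real.exp_pos _).le
    rw [div_le_iff₀ (root_pos x)]
    linarith [weight_le_one hp x, half_le_root hp x]

lemma summable_sigmaPrimitive {p : ℝ} (hp : 0 < p) {t : ℝ} (ht : 0 ≤ t) :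
    Summable fun x : roots p => weight p x / (x : ℝ) ^ 2 * (1 - Real.exp (-x * t)) := by
  refine Summable.of_nonneg_of_le (fun x => ?_) (fun x => ?_) (summable_root_inv_sq hp)
  all_goals
    have hx := root_pos x
    have h1 : Real.exp (-x * t) ≤ 1 := Real.exp_le_one_iff.2 (by nlinarith)
    have h2 := Real.exp_pos (-x * t)
    have hw := weight_pos hp x
    have hw1 := weight_le_one hp x
  · exact mul_nonneg (by positivity) (by linarith)
  · refine (mul_le_of_le_one_right (by positivity) (by linarith)).trans ?_
    exact div_le_div_of_nonneg_right hw1 (by positivity)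

lemma hasDerivAt_sigmaPrimitive {p : ℝ} (hp : 0 < p) {t : ℝ} (ht : 0 < t) :
    HasDerivAt (sigmaPrimitive p) (∑' x : roots p, weight p x / x * Real.exp (-x * t)) t := by
  -- On (t/2, ∞) the differentiated series is dominated by its values at t/2.
  have hmem : t ∈ Ioi (t / 2) := by simp only [mem_Ioi]; linarith
  refine hasDerivAt_tsum_of_isPreconnected
    (g := fun (x : roots p) t => weight p x / (x : ℝ) ^ 2 * (1 - Real.exp (-x * t)))
    (g' := fun (x : roots p) t => weight p x / x * Real.exp (-x * t))
    (summable_inv_root_mul_exp hp (by linarith : 0 < t / 2)) isOpen_Ioi isPreconnected_Ioi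
    (fun x z _ => ?_) (fun x z hz => ?_) hmem (summable_sigmaPrimitive hp ht.le) hmem
  · have h := ((hasDerivAt_exp_neg_mul x z).const_sub 1).const_mul (weight p x / (x : ℝ) ^ 2)
    refine h.congr_deriv ?_
    have := (root_pos x).ne'
    field_simp
  · have hx := root_pos x
    have hw := weight_pos hp x
    rw [Real.norm_of_nonneg (by positivity)]
    have : -(x : ℝ) * z ≤ -x * (t / 2) := by nlinarith [mem_Ioi.1 hz]
    gcongr

lemma hasDerivAt_deriv_sigmaPrimitive {p : ℝ} (hp : 0 < p) {t : ℝ} (ht : 0 < t) :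
    HasDerivAt (fun t => ∑' x : roots p, weight p x / x * Real.exp (-x * t))
      (-∑' x : roots p, weight p x * Real.exp (-x * t)) t := by
  have hmem : t ∈ Ioi (t / 2) := by simp only [mem_Ioi]; linarith
  rw [← tsum_neg]
  refine hasDerivAt_tsum_of_isPreconnected
    (g := fun (x : roots p) t => weight p x / x * Real.exp (-x * t))
    (g' := fun (x : roots p) t => -(weight p x * Real.exp (-x * t)))
    (summable_weight_mul hp (u := fun x : roots p => Real.exp (-x * (t / 2))) (fun x => (Real.exp_pos _).le)
      (summable_exp_neg_root hp (by linarith : 0 < t / 2))) isOpen_Ioi isPreconnected_Ioi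
    (fun x z _ => ?_) (fun x z hz => ?_) hmem (summable_inv_root_mul_exp hp ht) hmem
  · have h := (hasDerivAt_exp_neg_mul x z).const_mul (weight p x / (x : ℝ))
    refine h.congr_deriv ?_
    have := (root_pos x).ne'
    field_simp
  · have hx := root_pos x
    have hw := weight_pos hp x
    rw [norm_neg, Real.norm_of_nonneg (by positivity)]
    have : -(x : ℝ) * z ≤ -x * (t / 2) := by nlinarith [mem_Ioi.1 hz]
    gcongr

lemma sigma_ofReal (p t : ℝ) :
    sigma p t = ((∑' x : roots p, weight p x * Real.exp (-x * t) : ℝ) : ℂ) := by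
  rw [sigma, Complex.ofReal_tsum]
  refine tsum_congr fun x => ?_
  rw [sigmaTerm]
  push_cast
  rfl

/-! ### Differentiation of sine and cosine transforms -/

lemma integrable_sin_mul {μ : Measure ℝ} {φ : ℝ → ℝ} (hm : AEStronglyMeasurable φ μ)
    (h : Integrable (fun y => y * φ y) μ) (t : ℝ) : Integrable (fun y => Real.sin (y * t) * φ y) μ := by
  refine Integrable.mono (h.const_mul t) (AEStronglyMeasurable.mul
    (by fun_prop : Continuous fun y => Real.sin (y * t)).aestronglyMeasurable hm)
    (ae_of_all _ fun y => ?_)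
  rw [norm_mul, norm_mul, norm_mul, ← mul_assoc, ← norm_mul t, mul_comm t]
  exact mul_le_mul_of_nonneg_right (Real.abs_sin_le_abs) (norm_nonneg _)

lemma integrable_cos_mul {μ : Measure ℝ} {φ : ℝ → ℝ} (h : Integrable φ μ) (t : ℝ) :
    Integrable (fun y => Real.cos (y * t) * φ y) μ := by
  refine Integrable.mono h (AEStronglyMeasurable.mul
    (by fun_prop : Continuous fun y => Real.cos (y * t)).aestronglyMeasurable
    h.aestronglyMeasurable) (ae_of_all _ fun y => ?_)
  rw [norm_mul]
  exact mul_le_of_le_one_left (norm_nonneg _) (Real.abs_cos_le_one _)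

lemma hasDerivAt_integral_sin_mul {μ : Measure ℝ} {φ : ℝ → ℝ} (hm : AEStronglyMeasurable φ μ)
    (h : Integrable (fun y => y * φ y) μ) (t : ℝ) :
    HasDerivAt (fun t => ∫ y, Real.sin (y * t) * φ y ∂μ)
      (∫ y, Real.cos (y * t) * (y * φ y) ∂μ) t := by
  refine (hasDerivAt_integral_of_dominated_loc_of_deriv_le
    (F := fun t y => Real.sin (y * t) * φ y) (F' := fun t y => Real.cos (y * t) * (y * φ y))
    (bound := fun y => ‖y * φ y‖) univ_mem
    (Eventually.of_forall fun t => (integrable_sin_mul hm h t).aestronglyMeasurable)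
    (integrable_sin_mul hm h t) (integrable_cos_mul h t).aestronglyMeasurable
    (ae_of_all _ fun y x _ => ?_) h.norm (ae_of_all _ fun y x _ => ?_)).2
  · rw [norm_mul]
    exact mul_le_of_le_one_left (norm_nonneg _) (Real.abs_cos_le_one _)
  · have := (((hasDerivAt_id x).const_mul y).sin).mul_const (φ y)
    refine this.congr_deriv ?_
    simp only [id]
    ring

lemma hasDerivAt_integral_cos_mul {μ : Measure ℝ} {φ : ℝ → ℝ} (h0 : Integrable φ μ)
    (h : Integrable (fun y => y * φ y) μ) (t : ℝ) :
    HasDerivAt (fun t => ∫ y, Real.cos (y * t) * φ y ∂μ)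
      (-∫ y, Real.sin (y * t) * (y * φ y) ∂μ) t := by
  have hsin : Continuous fun y => Real.sin (y * t) := by fun_prop
  rw [← integral_neg]
  refine (hasDerivAt_integral_of_dominated_loc_of_deriv_le
    (F := fun t y => Real.cos (y * t) * φ y) (F' := fun t y => -(Real.sin (y * t) * (y * φ y)))
    (bound := fun y => ‖y * φ y‖) univ_mem
    (Eventually.of_forall fun t => (integrable_cos_mul h0 t).aestronglyMeasurable)
    (integrable_cos_mul h0 t) (hsin.aestronglyMeasurable.mul h.aestronglyMeasurable).neg
    (ae_of_all _ fun y x _ => ?_) h.norm (ae_of_all _ fun y x _ => ?_)).2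
  · rw [norm_neg, norm_mul]
    exact mul_le_of_le_one_left (norm_nonneg _) (Real.abs_sin_le_one _)
  · have := (((hasDerivAt_id x).const_mul y).cos).mul_const (φ y)
    refine this.congr_deriv ?_
    simp only [id]
    ring

/-! ### Tails of sine integrals -/

/-- The tail `∫_t^∞ sin u / u ^ n du`. -/
def sinTail (n : ℕ) (t : ℝ) : ℝ := ∫ u in Ioi t, Real.sin u / u ^ n

lemma integrableOn_sin_mul_div_pow {n : ℕ} (hn : 2 ≤ n) (b : ℝ) {t : ℝ} (ht : 0 < t) :
    IntegrableOn (fun u => Real.sin (u * b) / u ^ n) (Ioi t) := by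
  have hn' : (-n : ℝ) < -1 := by
    have : (2 : ℝ) ≤ n := by exact_mod_cast hn
    linarith
  refine Integrable.mono' (integrableOn_Ioi_rpow_of_lt hn' ht) ?_ ?_
  · exact Measurable.aestronglyMeasurable (by fun_prop)
  · filter_upwards [ae_restrict_mem measurableSet_Ioi] with u hu
    have hu' : 0 < u := ht.trans hu
    rw [norm_div, norm_pow, Real.norm_of_nonneg hu'.le, Real.rpow_neg hu'.le, Real.rpow_natCast,
      div_eq_mul_inv]
    exact mul_le_of_le_one_left (by positivity) (Real.abs_sin_le_one _)

lemma hasDerivAt_sinTail {n : ℕ} (hn : 2 ≤ n) {t : ℝ} (ht : 0 < t) :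
    HasDerivAt (sinTail n) (-(Real.sin t / t ^ n)) t := by
  have hi : ∀ a, 0 < a → IntegrableOn (fun u => Real.sin u / u ^ n) (Ioi a) := fun a ha => by
    simpa using integrableOn_sin_mul_div_pow hn 1 ha
  have hc : ContinuousOn (fun u => Real.sin u / u ^ n) (Ioi 0) :=
    ContinuousOn.div (by fun_prop) (by fun_prop) fun u hu => pow_ne_zero _ (ne_of_gt hu)
  have h2 : 0 < t / 2 := by linarith
  have hint : IntervalIntegrable (fun u => Real.sin u / u ^ n) volume (t / 2) t := by
    rw [intervalIntegrable_iff_integrableOn_Ioc_of_le (by linarith)]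
    exact (hi _ h2).mono_set Ioc_subset_Ioi_self
  have hd := (intervalIntegral.integral_hasDerivAt_right hint
    (hc.stronglyMeasurableAtFilter isOpen_Ioi t ht)
    (hc.continuousAt (isOpen_Ioi.mem_nhds ht))).const_sub (sinTail n (t / 2))
  refine hd.congr_of_eventuallyEq ?_
  filter_upwards [isOpen_Ioi.mem_nhds (show t ∈ Ioi (t / 2) by simp only [mem_Ioi]; linarith)]
    with x hx
  have hx' : t / 2 < x := hx
  have := intervalIntegral.integral_interval_add_Ioi (hi _ h2) (hi x (h2.trans hx'))
  rw [sinTail, sinTail, ← this]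
  ring

/-- Scaling moves t from the integrand to the limit of integration, so that derivatives in t are
elementary even where differentiation under the integral would destroy convergence. -/
lemma integral_sin_mul_div_pow {n : ℕ} {t : ℝ} (ht : 0 < t) :
    ∫ y in Ioi (1 : ℝ), Real.sin (y * t) / y ^ (n + 1) = t ^ n * sinTail (n + 1) t := by
  have h := integral_comp_mul_right_Ioi (fun u => Real.sin u / u ^ (n + 1)) 1 ht
  rw [one_mul, smul_eq_mul, ← sinTail] at h
  have h1 : ∀ y : ℝ, Real.sin (y * t) / (y * t) ^ (n + 1) =
      (t ^ (n + 1))⁻¹ * (Real.sin (y * t) / y ^ (n + 1)) := by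
    intro y
    rw [mul_pow, div_mul_eq_div_div, div_eq_mul_inv _ (t ^ (n + 1)), mul_comm]
  simp only [h1] at h
  rw [integral_const_mul] at h
  field_simp at h
  exact mul_left_cancel₀ ht.ne' (h.trans (by ring))

/-! ### The sine transform formula -/

/-- The reduced kernel on `(0, 1]` and twice the kernel on `(1, ∞)`. -/
def splitKernel (p y : ℝ) : ℝ := if y ≤ 1 then reducedKernel p y else 2 * planaKernel p y

lemma measurable_splitKernel (p : ℝ) : Measurable (splitKernel p) :=
  Measurable.ite measurableSet_Iic (measurable_reducedKernel p)
    ((measurable_planaKernel p).const_mul 2)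

lemma reducedBound_nonneg {p : ℝ} (hp : 0 < p) : 0 ≤ reducedBound p := by
  simpa using (reducedKernel_nonneg hp one_pos).trans (reducedKernel_le hp one_pos)

lemma integrableOn_Ioi_of_le {g : ℝ → ℝ} (hg : Measurable g) {C : ℝ}
    (h1 : ∀ y ∈ Ioc (0 : ℝ) 1, |g y| ≤ C)
    (h2 : ∀ y ∈ Ioi (1 : ℝ), |g y| ≤ 4 * Real.exp (-(2 * Real.pi * y))) :
    IntegrableOn g (Ioi 0) := by
  rw [← Ioc_union_Ioi_eq_Ioi (zero_le_one' ℝ), integrableOn_union]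
  constructor
  · refine Integrable.mono' (g := fun _ => C) (integrableOn_const (by simp))
      hg.aestronglyMeasurable ?_
    filter_upwards [ae_restrict_mem measurableSet_Ioc] with y hy using h1 y hy
  · refine Integrable.mono' ((exp_neg_integrableOn_Ioi 1 Real.two_pi_pos).const_mul 4)
      hg.aestronglyMeasurable ?_
    filter_upwards [ae_restrict_mem measurableSet_Ioi] with y hy
    rw [neg_mul]
    exact h2 y hy

lemma abs_splitKernel_le_of_le_one {p : ℝ} (hp : 0 < p) {y : ℝ} (hy : y ∈ Ioc (0 : ℝ) 1) :
    |splitKernel p y| ≤ reducedBound p * y := by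
  rw [splitKernel, if_pos hy.2]
  exact abs_reducedKernel_le hp hy.1

lemma abs_splitKernel_le_of_one_lt {p : ℝ} (hp : 0 < p) {y : ℝ} (hy : y ∈ Ioi (1 : ℝ)) :
    |splitKernel p y| ≤ 4 * Real.exp (-(2 * Real.pi * y)) := by
  have hy' : 1 < y := hy
  rw [splitKernel, if_neg (not_le.2 hy'), abs_mul, abs_two]
  linarith [abs_planaKernel_le_two_mul_exp hp hy'.le]

lemma integrableOn_splitKernel {p : ℝ} (hp : 0 < p) : IntegrableOn (splitKernel p) (Ioi 0) :=
  integrableOn_Ioi_of_le (measurable_splitKernel p) (C := reducedBound p)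
    (fun _ hy => (abs_splitKernel_le_of_le_one hp hy).trans
      (mul_le_of_le_one_right (reducedBound_nonneg hp) hy.2))
    fun _ hy => abs_splitKernel_le_of_one_lt hp hy

lemma integrableOn_splitKernel_div {p : ℝ} (hp : 0 < p) :
    IntegrableOn (fun y => splitKernel p y / y) (Ioi 0) := by
  refine integrableOn_Ioi_of_le ((measurable_splitKernel p).div measurable_id)
    (C := reducedBound p) (fun y hy => ?_) fun y hy => ?_
  · rw [abs_div, abs_of_pos hy.1, div_le_iff₀ hy.1]
    exact abs_splitKernel_le_of_le_one hp hy
  · have hy' : 1 < y := hy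
    rw [abs_div, abs_of_pos (one_pos.trans hy')]
    exact (div_le_self (abs_nonneg _) hy'.le).trans (abs_splitKernel_le_of_one_lt hp hy)

/-- The part 1 - w(0)/(πy) on (1, ∞) decays too slowly for two differentiations under the integral
and is split off as explicit tails. What remains is integrable enough. -/
lemma sigmaPrimitive_eq {p : ℝ} (hp : 0 < p) {t : ℝ} (ht : 0 < t) :
    sigmaPrimitive p t =
      (∫ y in Ioi (0 : ℝ), Real.sin (y * t) * (splitKernel p y / y ^ 2)) +
        (t * sinTail 2 t - weight p 0 / Real.pi * (t ^ 2 * sinTail 3 t)) := by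
  have hm : AEStronglyMeasurable (fun y => splitKernel p y / y ^ 2) (volume.restrict (Ioi 0)) :=
    ((measurable_splitKernel p).div (by fun_prop)).aestronglyMeasurable
  have hq : (fun y => y * (splitKernel p y / y ^ 2)) = fun y => splitKernel p y / y := by
    funext y
    rcases eq_or_ne y 0 with rfl | hy
    · simp
    · field_simp
  have h1 := integrable_sin_mul hm (hq ▸ integrableOn_splitKernel_div hp) t
  have h2 := integrableOn_sin_mul_div_pow (n := 2) le_rfl t one_pos
  have h3 := (integrableOn_sin_mul_div_pow (n := 3) (by norm_num) t one_pos).const_mul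
    (weight p 0 / Real.pi)
  have h4 : IntegrableOn ((Ioi 1).indicator fun y => Real.sin (y * t) / y ^ 2 -
      weight p 0 / Real.pi * (Real.sin (y * t) / y ^ 3)) (Ioi 0) :=
    ((integrable_indicator_iff measurableSet_Ioi).2 (h2.sub h3)).integrableOn
  have e2 := integral_sin_mul_div_pow (n := 1) ht
  have e3 := integral_sin_mul_div_pow (n := 2) ht
  rw [pow_one] at e2
  have e4 : ∫ y in Ioi (0 : ℝ), (Ioi 1).indicator (fun y => Real.sin (y * t) / y ^ 2 -
      weight p 0 / Real.pi * (Real.sin (y * t) / y ^ 3)) y =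
      ∫ y in Ioi (1 : ℝ), (Real.sin (y * t) / y ^ 2 -
        weight p 0 / Real.pi * (Real.sin (y * t) / y ^ 3)) := by
    rw [integral_indicator measurableSet_Ioi, Measure.restrict_restrict measurableSet_Ioi,
      inter_eq_left.2 (Ioi_subset_Ioi (zero_le_one' ℝ))]
  rw [← e2, ← e3, ← integral_const_mul, ← integral_sub h2 h3, ← e4,
    ← integral_add h1 h4, sigmaPrimitive_eq_integral hp ht.le]
  refine setIntegral_congr_fun measurableSet_Ioi fun y hy => ?_
  have hy' : y ≠ 0 := ne_of_gt hy
  have hpi := Real.pi_ne_zero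
  rcases le_or_gt y 1 with h | h
  · rw [indicator_of_notMem (notMem_Ioi.2 h), splitKernel, if_pos h]
    ring_nf
  · rw [indicator_of_mem (mem_Ioi.2 h), splitKernel, if_neg (not_le.2 h), reducedKernel]
    field_simp
    ring_nf

/-! ### The exponential sum as a sine transform -/

lemma tsum_weight_div_mul_exp {p : ℝ} (hp : 0 < p) {t : ℝ} (ht : 0 < t) :
    ∑' x : roots p, weight p x / x * Real.exp (-x * t) =
      (∫ y in Ioi (0 : ℝ), Real.cos (y * t) * (splitKernel p y / y)) +
        (sinTail 2 t - Real.sin t / t -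
          weight p 0 / Real.pi * (2 * t * sinTail 3 t - Real.sin t / t)) := by
  have hm : AEStronglyMeasurable (fun y => splitKernel p y / y ^ 2) (volume.restrict (Ioi 0)) :=
    ((measurable_splitKernel p).div (by fun_prop)).aestronglyMeasurable
  have hq : (fun y => y * (splitKernel p y / y ^ 2)) = fun y => splitKernel p y / y := by
    funext y
    rcases eq_or_ne y 0 with rfl | hy
    · simp
    · field_simp
  have h1 := hasDerivAt_integral_sin_mul hm (hq ▸ integrableOn_splitKernel_div hp) t
  have h2 := (hasDerivAt_id t).mul (hasDerivAt_sinTail (n := 2) le_rfl ht)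
  have h3 := (((hasDerivAt_id t).pow 2).mul
    (hasDerivAt_sinTail (n := 3) (by norm_num) ht)).const_mul (weight p 0 / Real.pi)
  have h := (h1.add (h2.sub h3)).congr_of_eventuallyEq (f₁ := sigmaPrimitive p) (by
    filter_upwards [isOpen_Ioi.mem_nhds (mem_Ioi.2 ht)] with u hu using sigmaPrimitive_eq hp hu)
  rw [(hasDerivAt_sigmaPrimitive hp ht).unique h]
  have hq' : ∀ y, y * (splitKernel p y / y ^ 2) = splitKernel p y / y := fun y => congrFun hq y
  simp only [hq', id, Pi.pow_apply]
  have ht' := ht.ne'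
  field_simp
  ring_nf

/-- The second differentiation. The derivative of `sinTail 2` cancels the sin t / t² coming from sin
t / t, leaving cos t / t. -/
lemma tsum_weight_mul_exp_aux {p : ℝ} (hp : 0 < p) {t : ℝ} (ht : 0 < t) :
    ∑' x : roots p, weight p x * Real.exp (-x * t) =
      (∫ y in Ioi (0 : ℝ), Real.sin (y * t) * splitKernel p y) + Real.cos t / t +
        weight p 0 / Real.pi * (2 * sinTail 3 t - Real.sin t / t ^ 2 - Real.cos t / t) := by
  have hq : ∀ y ∈ Ioi (0 : ℝ), y * (splitKernel p y / y) = splitKernel p y := fun y hy =>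
    mul_div_cancel₀ _ (ne_of_gt hy)
  have hi : IntegrableOn (fun y => y * (splitKernel p y / y)) (Ioi 0) :=
    (integrableOn_splitKernel hp).congr_fun (fun y hy => (hq y hy).symm) measurableSet_Ioi
  have h1 := hasDerivAt_integral_cos_mul (integrableOn_splitKernel_div hp) hi t
  have h2 := hasDerivAt_sinTail (n := 2) le_rfl ht
  have h3 := ((hasDerivAt_id t).const_mul 2).mul (hasDerivAt_sinTail (n := 3) (by norm_num) ht)
  have h4 := (Real.hasDerivAt_sin t).div (hasDerivAt_id t) ht.ne'
  have h := (h1.add ((h2.sub h4).sub ((h3.sub h4).const_mul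
    (weight p 0 / Real.pi)))).congr_of_eventuallyEq
      (f₁ := fun t => ∑' x : roots p, weight p x / x * Real.exp (-x * t)) (by
    filter_upwards [isOpen_Ioi.mem_nhds (mem_Ioi.2 ht)] with u hu
      using tsum_weight_div_mul_exp hp hu)
  have e := (hasDerivAt_deriv_sigmaPrimitive hp ht).unique h
  have e1 : ∫ y in Ioi (0 : ℝ), Real.sin (y * t) * (y * (splitKernel p y / y)) =
      ∫ y in Ioi (0 : ℝ), Real.sin (y * t) * splitKernel p y :=
    setIntegral_congr_fun measurableSet_Ioi fun y hy => by
      rw [hq y hy]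
  rw [e1] at e
  rw [neg_eq_iff_eq_neg.1 e]
  simp only [id]
  have ht' := ht.ne'
  field_simp
  ring_nf

lemma integral_Ioc_cos_mul {t : ℝ} (ht : t ≠ 0) :
    ∫ y in Ioc (0 : ℝ) 1, Real.cos (y * t) = Real.sin t / t := by
  rw [← intervalIntegral.integral_of_le zero_le_one, intervalIntegral.integral_comp_mul_right _ ht,
    integral_cos]
  simp [div_eq_inv_mul]

lemma integral_Ioc_sin_mul {t : ℝ} (ht : t ≠ 0) :
    ∫ y in Ioc (0 : ℝ) 1, Real.sin (y * t) = (1 - Real.cos t) / t := by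
  rw [← intervalIntegral.integral_of_le zero_le_one, intervalIntegral.integral_comp_mul_right _ ht,
    integral_sin]
  simp [div_eq_inv_mul]

lemma integrableOn_mul_inv_Ioc : IntegrableOn (fun y : ℝ => y * y⁻¹) (Ioc 0 1) :=
  (integrableOn_const (C := (1 : ℝ)) (by simp)).congr_fun
    (fun y hy => (mul_inv_cancel₀ hy.1.ne').symm) measurableSet_Ioc

/-- The left side and the integral both have derivative sin t / t on (0, ∞). The value of c is not
needed. -/
lemma exists_sinTail_three_eq : ∃ c : ℝ, ∀ t : ℝ, 0 < t →
    2 * sinTail 3 t - Real.sin t / t ^ 2 - Real.cos t / t =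
      c + ∫ y in Ioc (0 : ℝ) 1, Real.sin (y * t) * y⁻¹ := by
  have hd : ∀ t ∈ Ioi (0 : ℝ), HasDerivAt (fun t => 2 * sinTail 3 t - Real.sin t / t ^ 2 -
      Real.cos t / t - ∫ y in Ioc (0 : ℝ) 1, Real.sin (y * t) * y⁻¹) 0 t := by
    intro t ht
    have ht' : t ≠ 0 := ne_of_gt ht
    have h1 := (hasDerivAt_sinTail (n := 3) (by norm_num) ht).const_mul 2
    have h2 := (Real.hasDerivAt_sin t).div ((hasDerivAt_id t).pow 2) (pow_ne_zero 2 ht')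
    have h3 := (Real.hasDerivAt_cos t).div (hasDerivAt_id t) ht'
    have h4 := hasDerivAt_integral_sin_mul (μ := volume.restrict (Ioc (0 : ℝ) 1))
      (φ := fun y => y⁻¹) (by exact measurable_inv.aestronglyMeasurable)
      integrableOn_mul_inv_Ioc t
    refine (((h1.sub h2).sub h3).sub h4).congr_deriv ?_
    have e : ∫ y in Ioc (0 : ℝ) 1, Real.cos (y * t) * (y * y⁻¹) = Real.sin t / t := by
      rw [← integral_Ioc_cos_mul ht']
      refine setIntegral_congr_fun measurableSet_Ioc fun y hy => ?_
      rw [mul_inv_cancel₀ hy.1.ne', mul_one]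
    rw [e]
    simp only [id, Pi.pow_apply]
    field_simp
    ring
  obtain ⟨c, hc⟩ := isOpen_Ioi.exists_is_const_of_deriv_eq_zero (convex_Ioi (0 : ℝ)).isPreconnected
    (fun t ht => (hd t ht).differentiableAt.differentiableWithinAt) fun t ht => (hd t ht).deriv
  exact ⟨c, fun t ht => by linarith [hc t ht]⟩

/-! ### Integrability and size of the moments -/

lemma integrableOn_pow_mul_exp_neg (n : ℕ) {b : ℝ} (hb : 0 < b) :
    IntegrableOn (fun y : ℝ => y ^ n * Real.exp (-(b * y))) (Ioi 0) := by
  have := integrableOn_rpow_mul_exp_neg (a := n + 1) (by positivity) hb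
  simpa only [add_sub_cancel_right, Real.rpow_natCast] using this

lemma integral_pow_mul_exp_neg (n : ℕ) {b : ℝ} (hb : 0 < b) :
    ∫ y in Ioi (0 : ℝ), y ^ n * Real.exp (-(b * y)) = (1 / b) ^ (n + 1) * n.factorial := by
  have := Real.integral_rpow_mul_exp_neg_mul_Ioi (a := n + 1) (by positivity) hb
  rw [Real.Gamma_nat_eq_factorial] at this
  rw [← Real.rpow_natCast (1 / b), Nat.cast_succ, ← this]
  simp only [add_sub_cancel_right, Real.rpow_natCast]

lemma norm_pow_mul_planaKernel_le {p : ℝ} (hp : 0 < p) (n : ℕ) {y : ℝ} (hy : 0 < y) :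
    ‖y ^ (n + 1) * planaKernel p y‖ ≤ y ^ (n + 1) * Real.exp (-(2 * Real.pi * y)) +
      y ^ n * Real.exp (-(2 * Real.pi * y)) := by
  rw [norm_mul, Real.norm_of_nonneg (by positivity), Real.norm_eq_abs]
  calc _ ≤ y ^ (n + 1) * ((1 + 1 / y) * Real.exp (-(2 * Real.pi * y))) :=
        mul_le_mul_of_nonneg_left (abs_planaKernel_le_mul_exp hp hy) (by positivity)
    _ = _ := by
        field_simp
        ring

lemma integrableOn_pow_mul_planaKernel {p : ℝ} (hp : 0 < p) (n : ℕ) :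
    IntegrableOn (fun y => y ^ (n + 1) * planaKernel p y) (Ioi 0) := by
  have h1 := integrableOn_pow_mul_exp_neg (n + 1) Real.two_pi_pos
  have h2 := integrableOn_pow_mul_exp_neg n Real.two_pi_pos
  refine Integrable.mono' (h1.add h2)
    (by have := measurable_planaKernel p; exact Measurable.aestronglyMeasurable (by fun_prop)) ?_
  filter_upwards [ae_restrict_mem measurableSet_Ioi] with y hy
  exact norm_pow_mul_planaKernel_le hp n hy

/-- The powers of 1/(2π) are simply bounded by 1: the factorial cancels against the sine
coefficients, which suffices for t < 1. -/
lemma integral_norm_pow_mul_planaKernel_le {p : ℝ} (hp : 0 < p) (n : ℕ) :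
    ∫ y in Ioi (0 : ℝ), ‖y ^ (n + 1) * planaKernel p y‖ ≤ 2 * (n + 1).factorial := by
  have h1 := integrableOn_pow_mul_exp_neg (n + 1) Real.two_pi_pos
  have h2 := integrableOn_pow_mul_exp_neg n Real.two_pi_pos
  have hb : 1 / (2 * Real.pi) ≤ 1 := by
    rw [div_le_one Real.two_pi_pos]
    linarith [Real.pi_gt_three]
  have hb0 : 0 ≤ 1 / (2 * Real.pi) := by positivity
  have hf : (n.factorial : ℝ) ≤ (n + 1).factorial := by
    exact_mod_cast Nat.factorial_le n.le_succ
  calc _ ≤ ∫ y in Ioi (0 : ℝ), (y ^ (n + 1) * Real.exp (-(2 * Real.pi * y)) +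
        y ^ n * Real.exp (-(2 * Real.pi * y))) :=
        setIntegral_mono_on (integrableOn_pow_mul_planaKernel hp n).norm (h1.add h2)
          measurableSet_Ioi fun y hy => norm_pow_mul_planaKernel_le hp n hy
    _ = (1 / (2 * Real.pi)) ^ (n + 2) * (n + 1).factorial +
        (1 / (2 * Real.pi)) ^ (n + 1) * n.factorial := by
        rw [integral_add h1 h2, integral_pow_mul_exp_neg _ Real.two_pi_pos,
          integral_pow_mul_exp_neg _ Real.two_pi_pos]
    _ ≤ 1 * (n + 1).factorial + 1 * (n + 1).factorial := by
        gcongr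
        · exact pow_le_one₀ hb0 hb
        · exact pow_le_one₀ hb0 hb
    _ = _ := by ring

/-- Replacing `splitKernel` by 2K on (0, 1] adds (1 - cos t)/t and subtracts a sine integral. These
cancel the cosine term and the integral in the previous formulas, leaving 1/t and a constant. -/
lemma exists_tsum_weight_mul_exp {p : ℝ} (hp : 0 < p) : ∃ c : ℝ, ∀ t : ℝ, 0 < t →
    ∑' x : roots p, weight p x * Real.exp (-x * t) =
      1 / t + c + 2 * ∫ y in Ioi (0 : ℝ), Real.sin (y * t) * planaKernel p y := by
  obtain ⟨c, hc⟩ := exists_sinTail_three_eq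
  refine ⟨weight p 0 / Real.pi * c, fun t ht => ?_⟩
  have h1 : IntegrableOn (fun y => Real.sin (y * t) * planaKernel p y) (Ioi 0) :=
    integrable_sin_mul (measurable_planaKernel p).aestronglyMeasurable
      (by simpa [IntegrableOn] using integrableOn_pow_mul_planaKernel hp 0) t
  have h2 : IntegrableOn (fun y => Real.sin (y * t)) (Ioc 0 1) :=
    (Continuous.integrableOn_Icc (by fun_prop)).mono_set Ioc_subset_Icc_self
  have h3 : IntegrableOn (fun y => weight p 0 / Real.pi * (Real.sin (y * t) * y⁻¹)) (Ioc 0 1) :=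
    (integrable_sin_mul (by exact measurable_inv.aestronglyMeasurable)
      integrableOn_mul_inv_Ioc t).const_mul _
  have h4 : IntegrableOn ((Ioc 0 1).indicator fun y => Real.sin (y * t) -
      weight p 0 / Real.pi * (Real.sin (y * t) * y⁻¹)) (Ioi 0) :=
    ((integrable_indicator_iff measurableSet_Ioc).2 (h2.sub h3)).integrableOn
  have e4 : ∫ y in Ioi (0 : ℝ), (Ioc 0 1).indicator (fun y => Real.sin (y * t) -
      weight p 0 / Real.pi * (Real.sin (y * t) * y⁻¹)) y =
      ∫ y in Ioc (0 : ℝ) 1, (Real.sin (y * t) -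
        weight p 0 / Real.pi * (Real.sin (y * t) * y⁻¹)) := by
    rw [integral_indicator measurableSet_Ioc, Measure.restrict_restrict measurableSet_Ioc,
      inter_eq_left.2 Ioc_subset_Ioi_self]
  have e : ∫ y in Ioi (0 : ℝ), Real.sin (y * t) * splitKernel p y =
      2 * (∫ y in Ioi (0 : ℝ), Real.sin (y * t) * planaKernel p y) +
        ((1 - Real.cos t) / t -
          weight p 0 / Real.pi * ∫ y in Ioc (0 : ℝ) 1, Real.sin (y * t) * y⁻¹) := by
    rw [← integral_Ioc_sin_mul ht.ne', ← integral_const_mul, ← integral_const_mul,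
      ← integral_sub h2 h3, ← e4, ← integral_add (h1.const_mul 2) h4]
    refine setIntegral_congr_fun measurableSet_Ioi fun y hy => ?_
    have hy' : y ≠ 0 := ne_of_gt hy
    have hpi := Real.pi_ne_zero
    rcases le_or_gt y 1 with h | h
    · rw [indicator_of_mem (show y ∈ Ioc (0 : ℝ) 1 from ⟨hy, h⟩), splitKernel, if_pos h,
        reducedKernel]
      field_simp
      ring
    · rw [indicator_of_notMem fun h' => h.not_ge h'.2, splitKernel, if_neg (not_le.2 h)]
      ring_nf
  rw [tsum_weight_mul_exp_aux hp ht, e, hc t ht]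
  ring

/-! ### The generalized Bernoulli numbers of the second kind -/

/-- The moments of the kernel. -/
def moment (p : ℝ) (n : ℕ) : ℝ := ∫ y in Ioi (0 : ℝ), y ^ n * planaKernel p y

lemma mellin_planaKernel_natCast (p : ℝ) (n : ℕ) :
    mellin (fun y => (planaKernel p y : ℂ)) ((n : ℂ) + 1) = (moment p n : ℂ) := by
  rw [mellin, moment, ← integral_complex_ofReal]
  refine setIntegral_congr_fun measurableSet_Ioi fun y _ => ?_
  simp

lemma hasSum_integral_sin_mul_planaKernel {p : ℝ} (hp : 0 < p) {t : ℝ} (ht : 0 < t) (ht1 : t < 1) :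
    HasSum (fun k : ℕ => (-1) ^ k * t ^ (2 * k + 1) / (2 * k + 1).factorial * moment p (2 * k + 1))
      (∫ y in Ioi (0 : ℝ), Real.sin (y * t) * planaKernel p y) := by
  set c : ℕ → ℝ := fun k => (-1) ^ k * t ^ (2 * k + 1) / (2 * k + 1).factorial with hc
  have hint : ∀ k, IntegrableOn (fun y => c k * (y ^ (2 * k + 1) * planaKernel p y)) (Ioi 0) :=
    fun k => (integrableOn_pow_mul_planaKernel hp (2 * k)).const_mul (c k)
  -- The moment bound 2 (2k+1)! against t^{2k+1}/(2k+1)!; here t < 1 is used.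
  have hgeo : Summable fun k : ℕ => 2 * t * (t ^ 2) ^ k :=
    (summable_geometric_of_lt_one (by positivity) (by nlinarith)).mul_left _
  have hsum : Summable fun k => ∫ y in Ioi (0 : ℝ), ‖c k * (y ^ (2 * k + 1) * planaKernel p y)‖ := by
    refine Summable.of_nonneg_of_le (fun k => integral_nonneg fun y => norm_nonneg _)
      (fun k => ?_) hgeo
    have hk : (0 : ℝ) < (2 * k + 1).factorial := by exact_mod_cast Nat.factorial_pos _
    have hck : ‖c k‖ = t ^ (2 * k + 1) / (2 * k + 1).factorial := by
      simp [hc, abs_of_pos ht]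
    simp only [norm_mul (c k)]
    rw [integral_const_mul, hck]
    refine (mul_le_mul_of_nonneg_left (integral_norm_pow_mul_planaKernel_le hp (2 * k))
      (by positivity)).trans_eq ?_
    rw [pow_succ, pow_mul]
    field_simp
  have h := hasSum_integral_of_summable_integral_norm hint hsum
  have e : ∀ y : ℝ, ∑' k, c k * (y ^ (2 * k + 1) * planaKernel p y) =
      Real.sin (y * t) * planaKernel p y := by
    intro y
    refine (((Real.hasSum_sin (y * t)).mul_right (planaKernel p y)).congr_fun fun k => ?_).tsum_eq
    simp only [hc, mul_pow]
    ring
  simp only [e, integral_const_mul] at h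
  exact h

/-- The coefficients of the generating function, in terms of the moments. -/
def momentCoeff (p c : ℝ) : ℕ → ℝ
  | 0 => 1
  | 1 => c
  | n + 2 => -(2 * (n + 2) * Real.cos (Real.pi * (n + 2) / 2) * moment p (n + 1))

/-- Multiplication by t turns 1/t and c into the coefficients of index 0 and 1, and the sine series
into the even ones. The cosine in `momentCoeff` supplies the alternating sign at even indices and
vanishes at odd ones. -/
lemma exists_isBernoulliTwo {p : ℝ} (hp : 0 < p) :
    ∃ c, IsBernoulliTwo p (momentCoeff p c) := by
  obtain ⟨c, hc⟩ := exists_tsum_weight_mul_exp hp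
  refine ⟨c, fun t ht ht1 => ?_⟩
  rw [sigma_ofReal, hc t ht, ← Complex.ofReal_mul]
  refine Complex.hasSum_ofReal.2 ?_
  have h0 := (hasSum_integral_sin_mul_planaKernel hp ht ht1).mul_left (2 * t)
  have heven : HasSum (fun k : ℕ => momentCoeff p c (2 * k + 2) / (2 * k + 2).factorial *
      t ^ (2 * k + 2)) (2 * t * ∫ y in Ioi (0 : ℝ), Real.sin (y * t) * planaKernel p y) := by
    refine h0.congr_fun fun k => ?_
    have hcos : Real.cos (Real.pi * ((2 * k : ℕ) + 2) / 2) = (-1) ^ (k + 1) := by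
      rw [← Real.cos_nat_mul_pi]
      congr 1
      push_cast
      ring
    have hf : ((2 * k + 1).factorial : ℝ) ≠ 0 := by exact_mod_cast Nat.factorial_ne_zero _
    rw [momentCoeff, hcos, Nat.factorial_succ (2 * k + 1)]
    push_cast
    field_simp
    ring
  have hodd : HasSum (fun k : ℕ => momentCoeff p c (2 * k + 1 + 2) / (2 * k + 1 + 2).factorial *
      t ^ (2 * k + 1 + 2)) 0 := by
    refine hasSum_zero.congr_fun fun k => ?_
    have hcos : Real.cos (Real.pi * ((2 * k + 1 : ℕ) + 2) / 2) = 0 := by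
      rw [Real.cos_eq_zero_iff]
      refine ⟨k + 1, ?_⟩
      push_cast
      ring
    rw [momentCoeff, hcos]
    simp
  have h := HasSum.even_add_odd (f := fun n : ℕ => momentCoeff p c (n + 2) / (n + 2).factorial *
      t ^ (n + 2)) heven hodd
  rw [hasSum_nat_add_iff (f := fun n : ℕ => momentCoeff p c n / n.factorial * t ^ n)] at h
  suffices e : t * (1 / t + c + 2 * ∫ y in Ioi (0 : ℝ), Real.sin (y * t) * planaKernel p y) = _ from
    e ▸ h
  rw [add_zero, Finset.sum_range_succ, Finset.sum_range_one, momentCoeff, momentCoeff]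
  have ht' := ht.ne'
  simp only [Nat.factorial, pow_zero, pow_one, mul_one, Nat.cast_one, div_one]
  field_simp
  ring

/-! ### Uniqueness of the coefficients -/

lemma eq_zero_of_hasSum_mul_pow (n : ℕ) : ∀ {d : ℕ → ℝ},
    (∀ t : ℝ, 0 < t → t < 1 → HasSum (fun n => d n * t ^ n) 0) → d n = 0 := by
  have hzero : ∀ {d : ℕ → ℝ}, (∀ t : ℝ, 0 < t → t < 1 → HasSum (fun n => d n * t ^ n) 0) →
      d 0 = 0 := by
    intro d h
    have hlim : Tendsto (fun t : ℝ => ∑' n, d n * t ^ n) (𝓝[>] 0) (𝓝 (∑' n, d n * (0 : ℝ) ^ n)) := by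
      -- Convergence at t = 1/2 dominates the series on (0, 1/2), so its limit at 0 is the constant
      -- term.
      refine tendsto_tsum_of_dominated_convergence
        (h (1 / 2) (by norm_num) (by norm_num)).summable.norm (fun n => ?_) ?_
      · exact Tendsto.mono_left (Continuous.tendsto (by fun_prop) 0) nhdsWithin_le_nhds
      · filter_upwards [Ioo_mem_nhdsGT (show (0 : ℝ) < 1 / 2 by norm_num)] with t ht n
        rw [norm_mul, norm_mul, norm_pow, norm_pow, Real.norm_of_nonneg ht.1.le,
          Real.norm_of_nonneg (by norm_num : (0 : ℝ) ≤ 1 / 2)]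
        gcongr
        · exact ht.1.le
        · exact ht.2.le
    have hconst : Tendsto (fun t : ℝ => ∑' n, d n * t ^ n) (𝓝[>] 0) (𝓝 0) := by
      refine tendsto_const_nhds.congr' ?_
      filter_upwards [Ioo_mem_nhdsGT (zero_lt_one' ℝ)] with t ht
      exact (h t ht.1 ht.2).tsum_eq.symm
    rw [tsum_eq_single 0 fun n hn => by simp [hn]] at hlim
    simpa using tendsto_nhds_unique hlim hconst
  induction n with
  | zero => exact hzero
  | succ n ih =>
    intro d h
    -- The constant term vanishes, so division by t shifts the sequence.
    refine ih (d := fun n => d (n + 1)) fun t ht ht1 => ?_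
    have h1 := ((hasSum_nat_add_iff' 1).2 (h t ht ht1)).mul_left t⁻¹
    simp only [Finset.sum_range_one, hzero h, zero_mul, sub_zero, mul_zero] at h1
    refine h1.congr_fun fun n => ?_
    field_simp
    ring

lemma IsBernoulliTwo.unique {p : ℝ} {A B : ℕ → ℝ} (hA : IsBernoulliTwo p A)
    (hB : IsBernoulliTwo p B) : A = B := by
  funext n
  have h := eq_zero_of_hasSum_mul_pow n (d := fun n => A n / n.factorial - B n / n.factorial)
    fun t ht ht1 => by
      have := (hA t ht ht1).sub (hB t ht ht1)
      rw [sub_self] at this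
      refine Complex.hasSum_ofReal.1 (this.congr_fun fun n => ?_)
      push_cast
      ring
  have hf : (n.factorial : ℝ) ≠ 0 := by exact_mod_cast n.factorial_ne_zero
  rw [← sub_div, div_eq_zero_iff] at h
  exact sub_eq_zero.1 (h.resolve_right hf)

lemma isBernoulliTwo_bernoulliTwo {p : ℝ} (hp : 0 < p) : IsBernoulliTwo p (bernoulliTwo p) :=
  Classical.epsilon_spec (let ⟨_, h⟩ := exists_isBernoulliTwo hp; ⟨_, h⟩)

lemma bernoulliTwo_add_two {p : ℝ} (hp : 0 < p) (n : ℕ) :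
    bernoulliTwo p (n + 2) =
      -(2 * (n + 2) * Real.cos (Real.pi * (n + 2) / 2) * moment p (n + 1)) := by
  obtain ⟨c, hc⟩ := exists_isBernoulliTwo hp
  rw [(isBernoulliTwo_bernoulliTwo hp).unique hc, momentCoeff]

/-! ### The two formulas -/

lemma zeta_neg_natCast {p : ℝ} (hp : 0 < p) {m : ℕ} (hm : 1 ≤ m) :
    zeta p (-(m : ℂ)) = -(1 / ((m : ℂ) + 1)) * (bernoulliTwo p (m + 1) : ℂ) := by
  obtain ⟨n, rfl⟩ := Nat.exists_eq_add_of_le' hm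
  -- The functional equation at s = m + 1 has the same cosine and the same moment as B_{m+1}, so no
  -- case split on parity is needed.
  have h := zeta_one_sub hp (s := ((n + 1 : ℕ) : ℂ) + 1) (by simp; positivity)
  rw [mellin_planaKernel_natCast, show (1 : ℂ) - (((n + 1 : ℕ) : ℂ) + 1) = -((n + 1 : ℕ) : ℂ) by
    ring] at h
  have hn : (n : ℂ) + 1 + 1 ≠ 0 := by exact_mod_cast (n + 1).succ_ne_zero
  rw [h, bernoulliTwo_add_two hp]
  push_cast
  rw [show (n : ℂ) + 2 = n + 1 + 1 by ring]
  field_simp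

lemma eta_two_mul_natCast {p : ℝ} (hp : 0 < p) {m : ℕ} (hm : 1 ≤ m) :
    eta p (2 * (m : ℂ)) =
      (-1) ^ (m + 1) * (2 * (Real.pi : ℂ)) ^ (2 * m) / (2 * ((2 * m).factorial : ℂ)) *
        (bernoulliTwo p (2 * m) : ℂ) := by
  obtain ⟨n, rfl⟩ := Nat.exists_eq_add_of_le' hm
  have hs : (2 * ((n + 1 : ℕ) : ℂ)) = ((2 * n + 1 : ℕ) : ℂ) + 1 := by push_cast; ring
  have hcos : Real.cos (Real.pi * ((2 * n : ℕ) + 2) / 2) = (-1) ^ (n + 1) := by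
    rw [← Real.cos_nat_mul_pi]
    congr 1
    push_cast
    ring
  have hf : ((2 * n + 1).factorial : ℂ) ≠ 0 := by exact_mod_cast Nat.factorial_ne_zero _
  have hn : (2 * (n : ℂ) + 1 + 1) ≠ 0 := by exact_mod_cast (2 * n + 1).succ_ne_zero
  rw [hs, eta_eq_mellin hp (by simp; positivity), mellin_planaKernel_natCast,
    Complex.Gamma_nat_eq_factorial, ← Nat.cast_succ, Complex.cpow_natCast,
    show 2 * (n + 1) = 2 * n + 2 by ring, bernoulliTwo_add_two hp, hcos,
    Nat.factorial_succ (2 * n + 1), Nat.succ_eq_add_one]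
  push_cast
  rw [show (-1 : ℂ) ^ (n + 1 + 1) = -(-1) ^ (n + 1) by ring]
  field_simp
  -- The sign (-1)^{n+1} occurs twice, in the formula and in the cosine.
  rw [← pow_mul, mul_comm (n + 1), pow_mul, neg_one_sq, one_pow]
  ring

end Koshliakov

theorem mainTheorem2 (p : ℝ) (hp : 0 < p) :
    -- the objects in the two formulas are well defined
    (Koshliakov.IsZetaContinuation p (Koshliakov.zeta p) ∧
      (∀ s : ℂ, 1 < s.re →
        (∀ k : ℕ, 1 ≤ k → MeasureTheory.IntegrableOn
          (Koshliakov.bracketIntegrand s (2 * Real.pi * p * k) k) (Set.Ioi (0 : ℝ))) ∧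
        Summable (fun k : ℕ => Koshliakov.etaTerm p s (k + 1))) ∧
      (∀ t : ℂ, 0 < t.re → Summable (Koshliakov.sigmaTerm p t)) ∧
      Koshliakov.IsBernoulliTwo p (Koshliakov.bernoulliTwo p)) ∧
    -- the two formulas
    (∀ m : ℕ, 1 ≤ m →
      Koshliakov.zeta p (-(m : ℂ)) =
        -(1 / ((m : ℂ) + 1)) * (Koshliakov.bernoulliTwo p (m + 1) : ℂ)) ∧
    (∀ m : ℕ, 1 ≤ m →
      Koshliakov.eta p (2 * (m : ℂ)) =
        (-1) ^ (m + 1) * (2 * (Real.pi : ℂ)) ^ (2 * m) / (2 * ((2 * m).factorial : ℂ)) *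
          (Koshliakov.bernoulliTwo p (2 * m) : ℂ)) :=
  ⟨⟨Koshliakov.isZetaContinuation_zeta hp,
    fun _ hs => ⟨fun k _ => Koshliakov.integrableOn_bracketIntegrand (zero_lt_one.trans hs)
      (by have := Real.pi_pos; positivity) k, (Koshliakov.hasSum_etaTerm hp hs).summable⟩,
    fun _ ht => Koshliakov.summable_sigmaTerm hp ht, Koshliakov.isBernoulliTwo_bernoulliTwo hp⟩,
    fun _ hm => Koshliakov.zeta_neg_natCast hp hm, fun _ hm => Koshliakov.eta_two_mul_natCast hp hm⟩

end
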